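/- A unary automaton with $n$ states is a complete, accessible, deterministic finite automaton $(Q,\delta,q_0,F)$ over a one-letter alphabet $\{a\}$ with $|Q|=n$ states (transition function $\delta : Q\to Q$, initial state $q_0\in Q$, set of final states $F\subseteq Q$, every state being of the form $\delta^i(q_0)$ for some $i\ge 0$), two automata being identified when they differ only by the names of their states. Moore's state minimization algorithm, applied to such an automaton with $Q=\{1,\dots,n\}$, returns the one-state automaton if $F=\emptyset$ or $F=Q$; otherwise it starts from the partition $\{F,Q\setminus F\}$ and repeatedly replaces the current partition $\pi$ by the partition $\pi'$ in which $p,q$ are in the same class if and only if $\pi[p]=\pi[q]$ and $\pi[\delta(p)]=\pi[\delta(q)]$, until $\pi'=\pi$, and it returns the quotient automaton by $\pi$. Each $\pi'$ is computed by sorting the states lexicographically (by two stable counting sorts) according to the pairs $(\pi[p],\pi[\delta(p)])$ and numbering the classes in that order. Its running time is the number of elementary operations on a unit-cost random access machine. Theorem. Moore's algorithm halts on every unary automaton and, for the uniform distribution on unary automata with $n$ states, its average running time is $\Theta(n\log n)$ as $n\to\infty$. This holds however the states of the automata are labelled by $1,\dots,n$: for every choice, for each $n$, of one labelled representative of each isomorphism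 class of unary automata with $n$ states, the average of the running time over these representatives is $\Theta(n\log n)$. -/

import Mathlib

/-! ## A unit-cost random access machine

Programs of a small structured imperative language, acting on finitely many registers and arrays
of natural numbers. The only arithmetic operation is addition and the only tests are `=` and `<`.
The cost of a program run is the number of elementary operations carried out. -/

namespace Moore

/-- Registers (scalar variables). -/
inductive Reg
  | n | init | count | i | j | p | q | acc | tmp | label | changed | outSize | outInit
  deriving DecidableEq

/-- Arrays. `delta`, `fin` hold the input automaton, `outDelta`, `outFin` the output automaton. -/
inductive Arr
  | delta | fin | pi | piNew | s0 | s1 | cnt | ident | ord | sigma | outDelta | outFin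
  deriving DecidableEq

/-- Arithmetic expressions. -/
inductive Expr
  | const (k : ℕ)
  | reg (x : Reg)
  | get (a : Arr) (i : Expr)
  | add (e f : Expr)

/-- Boolean tests. -/
inductive Test
  | eq (e f : Expr)
  | lt (e f : Expr)

/-- Programs. -/
inductive Cmd
  | skip
  | assign (x : Reg) (e : Expr)
  | store (a : Arr) (i e : Expr)
  | seq (c d : Cmd)
  | ite (b : Test) (c d : Cmd)
  | while (b : Test) (c : Cmd)

/-- Memory contents. -/
structure Mem where
  reg : Reg → ℕ
  arr : Arr → ℕ → ℕ

/-- Value of an expression. -/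
def Expr.val (s : Mem) : Expr → ℕ
  | .const k => k
  | .reg x => s.reg x
  | .get a i => s.arr a (i.val s)
  | .add e f => e.val s + f.val s

/-- Number of elementary operations (constants, register and array reads, additions) needed to
evaluate an expression. -/
def Expr.cost : Expr → ℕ
  | .const _ => 1
  | .reg _ => 1
  | .get _ i => i.cost + 1
  | .add e f => e.cost + f.cost + 1

/-- Truth of a test. -/
def Test.holds (s : Mem) : Test → Prop
  | .eq e f => e.val s = f.val s
  | .lt e f => e.val s < f.val s

/-- Cost of evaluating a test and branching on its outcome. -/
def Test.cost : Test → ℕ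
  | .eq e f => e.cost + f.cost + 1
  | .lt e f => e.cost + f.cost + 1

/-- Write `v` into register `x`. -/
def Mem.setReg (s : Mem) (x : Reg) (v : ℕ) : Mem :=
  { s with reg := Function.update s.reg x v }

/-- Write `v` into cell `k` of array `a`. -/
def Mem.setArr (s : Mem) (a : Arr) (k v : ℕ) : Mem :=
  { s with arr := Function.update s.arr a (Function.update (s.arr a) k v) }

/-- Cost-counting big-step semantics: `Exec c s t s'` means that the program `c`, started in the
memory `s`, halts in the memory `s'` after exactly `t` elementary operations. -/
inductive Exec : Cmd → Mem → ℕ → Mem → Prop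
  | skip (s : Mem) : Exec .skip s 1 s
  | assign (x : Reg) (e : Expr) (s : Mem) :
      Exec (.assign x e) s (e.cost + 1) (s.setReg x (e.val s))
  | store (a : Arr) (i e : Expr) (s : Mem) :
      Exec (.store a i e) s (i.cost + e.cost + 1) (s.setArr a (i.val s) (e.val s))
  | seq {c d : Cmd} {s s' s'' : Mem} {t t' : ℕ} :
      Exec c s t s' → Exec d s' t' s'' → Exec (.seq c d) s (t + t') s''
  | iteTrue {b : Test} {c d : Cmd} {s s' : Mem} {t : ℕ} :
      b.holds s → Exec c s t s' → Exec (.ite b c d) s (b.cost + t) s'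
  | iteFalse {b : Test} {c d : Cmd} {s s' : Mem} {t : ℕ} :
      ¬ b.holds s → Exec d s t s' → Exec (.ite b c d) s (b.cost + t) s'
  | whileFalse {b : Test} {c : Cmd} {s : Mem} :
      ¬ b.holds s → Exec (.while b c) s b.cost s
  | whileTrue {b : Test} {c : Cmd} {s s' s'' : Mem} {t t' : ℕ} :
      b.holds s → Exec c s t s' → Exec (.while b c) s' t' s'' →
      Exec (.while b c) s (b.cost + t + t') s''

/-- Sequential composition of a list of programs. -/
def block : List Cmd → Cmd
  | [] => .skip
  | [c] => c
  | c :: d :: l => .seq c (block (d :: l))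

/-- `for x = lo, …, n - 1 do body`, where `n` is the content of the register `Reg.n`. -/
def forFrom (x : Reg) (lo : ℕ) (body : Cmd) : Cmd :=
  block [.assign x (.const lo),
    .while (.lt (.reg x) (.reg .n))
      (block [body, .assign x (.add (.reg x) (.const 1))])]

/-- Increment a register. -/
def incr (x : Reg) : Cmd := .assign x (.add (.reg x) (.const 1))

/-! ## Moore's state minimization algorithm for a one-letter alphabet

States are `0, …, n - 1`; `delta[p]` is the successor of `p` under the only letter, `fin[p]` is `1`
if `p` is final and `0` otherwise, and the register `init` holds the initial state. -/

/-- One stable counting-sort pass: writes into `dst` the states listed in `src`, sorted by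
`key` (the entries of `key` are smaller than `n`). -/
def countingSort (key src dst : Arr) : Cmd :=
  block [
    forFrom .i 0 (.store .cnt (.reg .i) (.const 0)),
    forFrom .i 0 (.store .cnt (.get key (.reg .i))
      (.add (.get .cnt (.get key (.reg .i))) (.const 1))),
    .assign .acc (.const 0),
    forFrom .i 0 (block [
      .assign .tmp (.get .cnt (.reg .i)),
      .store .cnt (.reg .i) (.reg .acc),
      .assign .acc (.add (.reg .acc) (.reg .tmp))]),
    forFrom .i 0 (block [
      .assign .p (.get src (.reg .i)),
      .store dst (.get .cnt (.get key (.reg .p))) (.reg .p),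
      .store .cnt (.get key (.reg .p))
        (.add (.get .cnt (.get key (.reg .p))) (.const 1))])]

/-- Computation of the refined partition `piNew` from `pi`: the pairs
`s[p] = (pi[p], pi[delta[p]])` are formed, the states are sorted lexicographically by `s` into
`sigma`, and consecutive states of `sigma` get the same label iff they have the same pair. -/
def refine : Cmd :=
  block [
    forFrom .p 0 (block [
      .store .s0 (.reg .p) (.get .pi (.reg .p)),
      .store .s1 (.reg .p) (.get .pi (.get .delta (.reg .p)))]),
    forFrom .p 0 (.store .ident (.reg .p) (.reg .p)),
    countingSort .s1 .ident .ord,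
    countingSort .s0 .ord .sigma,
    .assign .label (.const 0),
    .assign .q (.get .sigma (.const 0)),
    .store .piNew (.reg .q) (.reg .label),
    forFrom .j 1 (block [
      .assign .p (.get .sigma (.reg .j)),
      .ite (.eq (.get .s0 (.reg .p)) (.get .s0 (.reg .q)))
        (.ite (.eq (.get .s1 (.reg .p)) (.get .s1 (.reg .q))) .skip (incr .label))
        (incr .label),
      .store .piNew (.reg .p) (.reg .label),
      .assign .q (.reg .p)])]

/-- The main loop: `while pi ≠ piNew do (pi := piNew; refine)`, with `pi` undefined at the start,
so that the first test always succeeds. The register `changed` is `1` iff `pi ≠ piNew`. -/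
def mainLoop : Cmd :=
  block [
    .assign .changed (.const 1),
    .while (.eq (.reg .changed) (.const 1)) (block [
      forFrom .p 0 (.store .pi (.reg .p) (.get .piNew (.reg .p))),
      refine,
      .assign .changed (.const 0),
      forFrom .p 0 (.ite (.eq (.get .pi (.reg .p)) (.get .piNew (.reg .p)))
        .skip (.assign .changed (.const 1)))])]

/-- The quotient automaton by the partition `pi`, whose labels are `0, …, label`. -/
def quotient : Cmd :=
  block [
    .assign .outSize (.add (.reg .label) (.const 1)),
    .assign .outInit (.get .pi (.reg .init)),
    forFrom .p 0 (block [
      .store .outDelta (.get .pi (.reg .p)) (.get .pi (.get .delta (.reg .p))),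
      .store .outFin (.get .pi (.reg .p)) (.get .fin (.reg .p))])]

/-- Return the one-state automaton whose state is final (`b = 1`) or not (`b = 0`). -/
def returnTrivial (b : ℕ) : Cmd :=
  block [
    .assign .outSize (.const 1),
    .assign .outInit (.const 0),
    .store .outDelta (.const 0) (.const 0),
    .store .outFin (.const 0) (.const b)]

/-- Moore's algorithm: the cases `F = ∅` and `F = Q` are treated apart; otherwise `piNew` is
initialized to the partition into non-final and final states, the main loop is run, and the
quotient automaton is built. -/
def mooreProgram : Cmd :=
  block [
    .assign .count (.const 0),
    forFrom .p 0 (.assign .count (.add (.reg .count) (.get .fin (.reg .p)))),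
    .ite (.eq (.reg .count) (.const 0))
      (returnTrivial 0)
      (.ite (.eq (.reg .count) (.reg .n))
        (returnTrivial 1)
        (block [
          forFrom .p 0 (.store .piNew (.reg .p) (.get .fin (.reg .p))),
          mainLoop,
          quotient]))]

/-! ## Unary automata and the running time -/

/-- Complete deterministic automata over a one-letter alphabet with state set `{0, …, n - 1}`. -/
abbrev UnaryDFA (n : ℕ) := DFA Unit (Fin n)

/-- Every state is reached from the initial state by some word. -/
def Accessible {n : ℕ} (M : UnaryDFA n) : Prop :=
  ∀ p : Fin n, ∃ w : List Unit, M.eval w = p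

/-- Two automata are isomorphic if they differ by a relabelling of the states only. -/
def Isomorphic {n : ℕ} (M N : UnaryDFA n) : Prop :=
  ∃ e : Fin n ≃ Fin n, DFA.reindex e M = N

/-- `S` contains exactly one labelled representative of each unary accessible automaton with
`n` states (automata being counted up to isomorphism). -/
def IsSystemOfUnaryAutomata {n : ℕ} (S : Finset (UnaryDFA n)) : Prop :=
  (∀ M ∈ S, Accessible M) ∧
    ∀ M : UnaryDFA n, Accessible M → ∃! N, N ∈ S ∧ Isomorphic M N

open Classical in
/-- The initial memory for the input `M`; all cells not used by the input are `0`. -/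
noncomputable def inputMem {n : ℕ} (M : UnaryDFA n) : Mem where
  reg
    | .n => n
    | .init => M.start
    | _ => 0
  arr
    | .delta => fun k => if h : k < n then M.step ⟨k, h⟩ () else 0
    | .fin => fun k => if h : k < n then (if (⟨k, h⟩ : Fin n) ∈ M.accept then 1 else 0) else 0
    | _ => fun _ => 0

/-- Moore's algorithm halts on input `M` after exactly `t` elementary operations. -/
def HaltsIn {n : ℕ} (M : UnaryDFA n) (t : ℕ) : Prop :=
  ∃ s : Mem, Exec mooreProgram (inputMem M) t s

/-- The running time of Moore's algorithm on input `M`. The semantics is deterministic, so at most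
one `t` satisfies `HaltsIn M t`. -/
noncomputable def time {n : ℕ} (M : UnaryDFA n) : ℕ :=
  sInf {t | HaltsIn M t}

/-- The average running time of Moore's algorithm for the uniform distribution on `S`. -/
noncomputable def averageTime {n : ℕ} (S : Finset (UnaryDFA n)) : ℝ :=
  (∑ M ∈ S, (time M : ℝ)) / (S.card : ℝ)

end Moore

namespace Moore

/-! ## Determinism, frames and a total-correctness logic with time bounds -/

/-! Let the depth of an automaton be the least `k` such that words of length `k` separate no two
states that shorter words leave together. The main loop makes exactly `depth` rounds, each of cost
linear in `n`, so the running time lies between `n * depth` and a constant times `(n + 1) * (depth +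
1)` (`time_bounds`). What remains is to show that the average depth is of order `log n`.

An accessible automaton has no nontrivial automorphism, so each isomorphism class has exactly `n!`
labelled members, and depth is invariant under relabelling. Counting in any system of
representatives is therefore counting labelled accessible automata (`card_filter_mul_factorial`),
and it suffices to fix the transition map and the initial state and to let the set `F` of final
states vary over all `2 ^ n` sets (`mul_card_filter_le`).

Upper bound: if some `F` separates `p` and `q` at length `k` but not earlier, the `k` conditions
that `p` and `q` agree up to that length are independent, so a random `F` satisfies them with
probability at most `2 ^ (-k)` (`card_agree_mul_two_pow_le`). Summing over pairs, depth exceeds `k`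
with probability at most `n ^ 2 / 2 ^ k`. For `k` about `3 log₂ n` this is at most `1 / n`, and
there the crude bound `n + 1` on the depth is enough.

Lower bound: if `F` is stable at `k`, its indicator along the orbit of the initial state obeys a
recurrence of order `k`, so there are at most `2 ^ k * 2 ^ 2 ^ k` such `F` (`card_stable_le`). For
`k = log₂ n - 1` (logarithm rounded down) this is at most half of all sets. -/

theorem Exec.deterministic {c : Cmd} {s : Mem} {t : ℕ} {u : Mem} (h : Exec c s t u) :
    ∀ {t' : ℕ} {u' : Mem}, Exec c s t' u' → t = t' ∧ u = u' := by
  induction h with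
  | skip s => intro t' u' h'; cases h'; exact ⟨rfl, rfl⟩
  | assign x e s => intro t' u' h'; cases h'; exact ⟨rfl, rfl⟩
  | store a i e s => intro t' u' h'; cases h'; exact ⟨rfl, rfl⟩
  | seq h1 h2 ih1 ih2 =>
    intro t' u' h'
    cases h' with
    | seq g1 g2 =>
      obtain ⟨rfl, rfl⟩ := ih1 g1
      obtain ⟨rfl, rfl⟩ := ih2 g2
      exact ⟨rfl, rfl⟩
  | iteTrue hb h1 ih1 =>
    intro t' u' h'
    cases h' with
    | iteTrue _ g1 => obtain ⟨rfl, rfl⟩ := ih1 g1; exact ⟨rfl, rfl⟩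
    | iteFalse hb' _ => exact absurd hb hb'
  | iteFalse hb h1 ih1 =>
    intro t' u' h'
    cases h' with
    | iteTrue hb' _ => exact absurd hb' hb
    | iteFalse _ g1 => obtain ⟨rfl, rfl⟩ := ih1 g1; exact ⟨rfl, rfl⟩
  | whileFalse hb =>
    intro t' u' h'
    cases h' with
    | whileFalse _ => exact ⟨rfl, rfl⟩
    | whileTrue hb' _ _ => exact absurd hb' hb
  | whileTrue hb h1 h2 ih1 ih2 =>
    intro t' u' h'
    cases h' with
    | whileFalse hb' => exact absurd hb hb'
    | whileTrue _ g1 g2 =>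
      obtain ⟨rfl, rfl⟩ := ih1 g1
      obtain ⟨rfl, rfl⟩ := ih2 g2
      exact ⟨rfl, rfl⟩

/-- The registers a program may write. -/
def Cmd.regs : Cmd → List Reg
  | .skip => []
  | .assign x _ => [x]
  | .store _ _ _ => []
  | .seq c d => c.regs ++ d.regs
  | .ite _ c d => c.regs ++ d.regs
  | .while _ c => c.regs

/-- The arrays a program may write. -/
def Cmd.arrs : Cmd → List Arr
  | .skip => []
  | .assign _ _ => []
  | .store a _ _ => [a]
  | .seq c d => c.arrs ++ d.arrs
  | .ite _ c d => c.arrs ++ d.arrs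
  | .while _ c => c.arrs

/-- The memories `s` and `s'` agree on everything the program `c` cannot write. -/
def Cmd.Frame (c : Cmd) (s s' : Mem) : Prop :=
  (∀ a, a ∉ c.arrs → s'.arr a = s.arr a) ∧ ∀ x, x ∉ c.regs → s'.reg x = s.reg x

/-- Invariants and postconditions below mention only what a program changes; the preservation of
everything else is read off syntactically from here. -/
theorem Exec.frame {c : Cmd} {s : Mem} {t : ℕ} {s' : Mem} (h : Exec c s t s') :
    c.Frame s s' := by
  induction h with
  | skip s => exact ⟨fun _ _ => rfl, fun _ _ => rfl⟩
  | assign x e s =>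
    refine ⟨fun _ _ => rfl, fun y hy => ?_⟩
    simp only [Cmd.regs, List.mem_singleton] at hy
    simp [Mem.setReg, hy]
  | store a i e s =>
    refine ⟨fun b hb => ?_, fun _ _ => rfl⟩
    simp only [Cmd.arrs, List.mem_singleton] at hb
    simp [Mem.setArr, hb]
  | seq _ _ ih1 ih2 =>
    refine ⟨fun a ha => ?_, fun x hx => ?_⟩
    · simp only [Cmd.arrs, List.mem_append, not_or] at ha
      rw [ih2.1 a ha.2, ih1.1 a ha.1]
    · simp only [Cmd.regs, List.mem_append, not_or] at hx
      rw [ih2.2 x hx.2, ih1.2 x hx.1]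
  | iteTrue _ _ ih =>
    refine ⟨fun a ha => ?_, fun x hx => ?_⟩
    · simp only [Cmd.arrs, List.mem_append, not_or] at ha
      exact ih.1 a ha.1
    · simp only [Cmd.regs, List.mem_append, not_or] at hx
      exact ih.2 x hx.1
  | iteFalse _ _ ih =>
    refine ⟨fun a ha => ?_, fun x hx => ?_⟩
    · simp only [Cmd.arrs, List.mem_append, not_or] at ha
      exact ih.1 a ha.2
    · simp only [Cmd.regs, List.mem_append, not_or] at hx
      exact ih.2 x hx.2
  | whileFalse _ => exact ⟨fun _ _ => rfl, fun _ _ => rfl⟩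
  | whileTrue _ _ _ ih1 ih2 =>
    exact ⟨fun a ha => (ih2.1 a ha).trans (ih1.1 a ha), fun x hx => (ih2.2 x hx).trans (ih1.2 x hx)⟩

/-- Started in `s`, the program `c` halts after at least `l` and at most `h` elementary operations
in a memory satisfying `Q`. -/
def Spec (c : Cmd) (s : Mem) (l h : ℕ) (Q : Mem → Prop) : Prop :=
  ∃ t s', Exec c s t s' ∧ l ≤ t ∧ t ≤ h ∧ Q s'

theorem Spec.mono {c : Cmd} {s : Mem} {l h l' h' : ℕ} {Q Q' : Mem → Prop} (H : Spec c s l h Q)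
    (hl : l' ≤ l) (hh : h ≤ h') (hQ : ∀ u, c.Frame s u → Q u → Q' u) : Spec c s l' h' Q' := by
  obtain ⟨t, u, e, h1, h2, h3⟩ := H
  exact ⟨t, u, e, hl.trans h1, h2.trans hh, hQ u e.frame h3⟩

theorem Spec.seq {c d : Cmd} {s : Mem} {l h l' h' : ℕ} {P Q : Mem → Prop} (H : Spec c s l h P)
    (H' : ∀ u, c.Frame s u → P u → Spec d u l' h' Q) :
    Spec (.seq c d) s (l + l') (h + h') Q := by
  obtain ⟨t, u, e, h1, h2, h3⟩ := H
  obtain ⟨t', u', e', h1', h2', h3'⟩ := H' u e.frame h3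
  exact ⟨_, u', .seq e e', by omega, by omega, h3'⟩

/-- Used where only an upper bound matters: a total budget `k` is fixed and each command hands on
what it leaves. -/
theorem Spec.seq_le {c d : Cmd} {s : Mem} {l h k : ℕ} {P Q : Mem → Prop} (H : Spec c s l h P)
    (hh : h ≤ k) (H' : ∀ u, c.Frame s u → P u → Spec d u 0 (k - h) Q) :
    Spec (.seq c d) s 0 k Q :=
  (H.seq H').mono (Nat.zero_le _) (by omega) fun _ _ h => h

theorem Spec.assign {x : Reg} {e : Expr} {s : Mem} {Q : Mem → Prop}
    (H : Q (s.setReg x (e.val s))) : Spec (.assign x e) s 0 (e.cost + 1) Q :=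
  ⟨_, _, .assign x e s, Nat.zero_le _, le_rfl, H⟩

theorem Spec.store {a : Arr} {i e : Expr} {s : Mem} {Q : Mem → Prop}
    (H : Q (s.setArr a (i.val s) (e.val s))) :
    Spec (.store a i e) s 0 (i.cost + e.cost + 1) Q :=
  ⟨_, _, .store a i e s, Nat.zero_le _, le_rfl, H⟩

theorem Spec.ite {b : Test} {c d : Cmd} {s : Mem} {l h : ℕ} {Q : Mem → Prop}
    (H : b.holds s → Spec c s l h Q) (H' : ¬ b.holds s → Spec d s l h Q) :
    Spec (.ite b c d) s l (b.cost + h) Q := by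
  by_cases hb : b.holds s
  · obtain ⟨t, u, e, h1, h2, h3⟩ := H hb
    exact ⟨_, u, .iteTrue hb e, by omega, by omega, h3⟩
  · obtain ⟨t, u, e, h1, h2, h3⟩ := H' hb
    exact ⟨_, u, .iteFalse hb e, by omega, by omega, h3⟩

@[simp] theorem Mem.setReg_arr (s : Mem) (x : Reg) (v : ℕ) : (s.setReg x v).arr = s.arr := rfl

@[simp] theorem Mem.setArr_reg (s : Mem) (a : Arr) (k v : ℕ) : (s.setArr a k v).reg = s.reg := rfl

@[simp] theorem Mem.setReg_reg_self (s : Mem) (x : Reg) (v : ℕ) : (s.setReg x v).reg x = v := by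
  simp [Mem.setReg]

theorem Mem.setReg_reg (s : Mem) (x y : Reg) (v : ℕ) :
    (s.setReg x v).reg y = if y = x then v else s.reg y := by
  simp [Mem.setReg, Function.update_apply]

theorem Mem.setArr_arr (s : Mem) (a b : Arr) (k v m : ℕ) :
    (s.setArr a k v).arr b m = if b = a ∧ m = k then v else s.arr b m := by
  by_cases hb : b = a
  · subst hb
    simp [Mem.setArr, Function.update_apply]
  · simp [Mem.setArr, hb]

/-- Induction on the number `m` of rounds left. A round costs 3 for the test, at most 50 for the
body and 4 for the increment, whence 57; the final 3 pays for the failing test. -/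
theorem Spec.while_of_invariant {x : Reg} {body : Cmd} {N : ℕ} (I : ℕ → Mem → Prop)
    (hx : x ≠ .n) (hxb : x ∉ body.regs) (hnb : Reg.n ∉ body.regs)
    (hstep : ∀ i s, i < N → s.reg x = i → s.reg .n = N → I i s →
      Spec body s 0 50 (fun u => I (i + 1) (u.setReg x (i + 1)))) :
    ∀ (m i : ℕ) (s : Mem), i + m = N → s.reg x = i → s.reg .n = N → I i s →
      Spec (.while (.lt (.reg x) (.reg .n))
        (block [body, .assign x (.add (.reg x) (.const 1))])) s m (57 * m + 3) (I N) := by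
  intro m
  induction m with
  | zero =>
    intro i s hi hsx hsn hI
    refine ⟨_, s, .whileFalse ?_, Nat.zero_le _, ?_, ?_⟩
    · simp only [Test.holds, Expr.val]; omega
    · simp [Test.cost, Expr.cost]
    · rwa [← hi]
  | succ m ih =>
    intro i s hi hsx hsn hI
    obtain ⟨t, u, e, -, h2, h3⟩ := hstep i s (by omega) hsx hsn hI
    have hux : u.reg x = i := by rw [e.frame.2 x hxb, hsx]
    have hun : u.reg .n = N := by rw [e.frame.2 _ hnb, hsn]
    obtain ⟨t', u', e', h1', h2', h3'⟩ := ih (i + 1) (u.setReg x (i + 1)) (by omega) (by simp)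
      (by rw [Mem.setReg_reg, if_neg hx.symm, hun]) h3
    have ea : Exec (.assign x (.add (.reg x) (.const 1))) u 4 (u.setReg x (i + 1)) := by
      have := Exec.assign x (.add (.reg x) (.const 1)) u
      simpa [Expr.cost, Expr.val, hux] using this
    refine ⟨_, u', .whileTrue ?_ (.seq e ea) e', ?_, ?_, h3'⟩
    · simp only [Test.holds, Expr.val]; omega
    · omega
    · simp only [Test.cost, Expr.cost]; omega

/-- Rule for counting loops whose body takes at most `50` elementary operations. -/
theorem Spec.forFrom {x : Reg} {lo : ℕ} {body : Cmd} {s : Mem} {N : ℕ} (I : ℕ → Mem → Prop)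
    (hn : s.reg .n = N) (hlo : lo ≤ N)
    (hx : x ≠ .n) (hxb : x ∉ body.regs) (hnb : Reg.n ∉ body.regs)
    (h0 : I lo (s.setReg x lo))
    (hstep : ∀ i u, lo ≤ i → i < N → u.reg x = i → u.reg .n = N →
      (Moore.forFrom x lo body).Frame s u → I i u →
      Spec body u 0 50 (fun v => I (i + 1) (v.setReg x (i + 1)))) :
    Spec (Moore.forFrom x lo body) s (N - lo) (60 * (N + 1)) (I N) := by
  -- The invariant is strengthened by the frame relation to the memory before the loop, so that the
  -- body may use any data the loop never writes.
  have key := Spec.while_of_invariant (x := x) (body := body) (N := N)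
    (fun i u => lo ≤ i ∧ (Moore.forFrom x lo body).Frame s u ∧ I i u) hx hxb hnb
    (by
      rintro i u hi hux hun ⟨h1, h2, h3⟩
      refine (hstep i u h1 hi hux hun h2 h3).mono le_rfl le_rfl fun v hv hI => ⟨by omega, ?_, hI⟩
      refine ⟨fun a ha => ?_, fun y hy => ?_⟩
      · have : a ∉ body.arrs := by
          simpa [Moore.forFrom, block, Cmd.arrs] using ha
        rw [Mem.setReg_arr, hv.1 a this, h2.1 a ha]
      · have : y ≠ x ∧ y ∉ body.regs := by
          simp [Moore.forFrom, block, Cmd.regs] at hy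
          tauto
        rw [Mem.setReg_reg, if_neg this.1, hv.2 y this.2, h2.2 y hy])
    (N - lo) lo (s.setReg x lo) (by omega) (by simp)
    (by rw [Mem.setReg_reg, if_neg hx.symm, hn])
    ⟨le_rfl, ⟨fun _ _ => rfl, fun y hy => by
      have : y ≠ x := by
        simp [Moore.forFrom, block, Cmd.regs] at hy
        tauto
      rw [Mem.setReg_reg, if_neg this]⟩, h0⟩
  have := Spec.seq (c := .assign x (.const lo)) (s := s) (P := fun u => u = s.setReg x lo)
    (Spec.assign rfl) (fun u _ hu => hu ▸ key)
  refine this.mono (by omega) ?_ fun u _ h => h.2.2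
  simp only [Expr.cost]; omega

/-! ## Counting sort -/

theorem Spec.of_exec {c : Cmd} {s u : Mem} {t h : ℕ} {Q : Mem → Prop} (e : Exec c s t u)
    (ht : t ≤ h) (hQ : Q u) : Spec c s 0 h Q :=
  ⟨t, u, e, Nat.zero_le _, ht, hQ⟩

theorem count_lt_succ (f : ℕ → ℕ) (v n : ℕ) :
    Nat.count (fun j => f j < v + 1) n
      = Nat.count (fun j => f j < v) n + Nat.count (fun j => f j = v) n := by
  induction n with
  | zero => simp
  | succ n ih =>
    simp only [Nat.count_succ, ih]
    split_ifs <;> omega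

theorem count_lt_mono (f : ℕ → ℕ) {v w : ℕ} (h : v ≤ w) (n : ℕ) :
    Nat.count (fun j => f j < v) n ≤ Nat.count (fun j => f j < w) n :=
  Nat.count_mono_left (fun _ _ hk => lt_of_lt_of_le hk h)

/-- The position of the `i`-th item after a stable sort of `n` items with keys `f`. -/
def sortRank (f : ℕ → ℕ) (n i : ℕ) : ℕ :=
  Nat.count (fun j => f j < f i) n + Nat.count (fun j => f j = f i) i

theorem sortRank_lt_count (f : ℕ → ℕ) {n i : ℕ} (hi : i < n) :
    sortRank f n i < Nat.count (fun j => f j < f i + 1) n := by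
  rw [count_lt_succ, sortRank]
  exact Nat.add_lt_add_left (Nat.count_strict_mono (p := fun j => f j = f i) rfl hi) _

theorem sortRank_lt (f : ℕ → ℕ) {n i : ℕ} (hi : i < n) : sortRank f n i < n :=
  (sortRank_lt_count f hi).trans_le (Nat.count_le _)

theorem sortRank_lt_of_lt (f : ℕ → ℕ) {n i j : ℕ} (hi : i < n)
    (h : f i < f j ∨ f i = f j ∧ i < j) : sortRank f n i < sortRank f n j := by
  rcases h with h | ⟨h, hij⟩
  · exact (sortRank_lt_count f hi).trans_le
      ((count_lt_mono f h n).trans (Nat.le_add_right _ _))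
  · rw [sortRank, sortRank, h]
    exact Nat.add_lt_add_left (Nat.count_strict_mono (p := fun k => f k = f j) h hij) _

theorem sortRank_lt_iff (f : ℕ → ℕ) {n i j : ℕ} (hi : i < n) (hj : j < n) :
    sortRank f n i < sortRank f n j ↔ f i < f j ∨ f i = f j ∧ i < j := by
  refine ⟨fun h => ?_, sortRank_lt_of_lt f hi⟩
  by_contra hc
  rcases eq_or_ne i j with rfl | hne
  · exact lt_irrefl _ h
  · exact absurd (sortRank_lt_of_lt f hj (show f j < f i ∨ f j = f i ∧ j < i by omega)) (by omega)

theorem sortRank_bijOn (f : ℕ → ℕ) (n : ℕ) :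
    Set.BijOn (sortRank f n) (Set.Iio n) (Set.Iio n) := by
  have hm : Set.MapsTo (sortRank f n) (Set.Iio n) (Set.Iio n) := fun i hi => sortRank_lt f hi
  have hinj : Set.InjOn (sortRank f n) (Set.Iio n) := by
    intro i hi j hj h
    have h1 := sortRank_lt_iff f hi hj
    have h2 := sortRank_lt_iff f hj hi
    omega
  exact ((Set.finite_Iio n).injOn_iff_bijOn_of_mapsTo hm).1 hinj

theorem count_comp_of_bijOn {g : ℕ → ℕ} {n : ℕ} (hg : Set.BijOn g (Set.Iio n) (Set.Iio n))
    (P : ℕ → Prop) [DecidablePred P] :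
    Nat.count (fun j => P (g j)) n = Nat.count P n := by
  simp only [Nat.count_eq_card_filter_range]
  refine Finset.card_bij (fun j _ => g j) ?_ ?_ ?_
  · intro j hj
    simp only [Finset.mem_filter, Finset.mem_range] at hj ⊢
    exact ⟨hg.mapsTo hj.1, hj.2⟩
  · intro i hi j hj h
    simp only [Finset.mem_filter, Finset.mem_range] at hi hj
    exact hg.injOn hi.1 hj.1 h
  · intro k hk
    simp only [Finset.mem_filter, Finset.mem_range] at hk
    obtain ⟨j, hj, rfl⟩ := hg.surjOn hk.1
    exact ⟨j, by simpa using ⟨hj, hk.2⟩, rfl⟩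

theorem bijOn_of_leftInvOn {r o : ℕ → ℕ} {s : Set ℕ} (hr : Set.BijOn r s s)
    (h : ∀ p ∈ s, o (r p) = p) : Set.BijOn o s s := by
  refine Set.BijOn.mk (fun k hk => ?_) (fun j hj k hk e => ?_) (fun p hp => ?_)
  · obtain ⟨p, hp, rfl⟩ := hr.surjOn hk
    rwa [h p hp]
  · obtain ⟨p, hp, rfl⟩ := hr.surjOn hj
    obtain ⟨q, hq, rfl⟩ := hr.surjOn hk
    rw [h p hp, h q hq] at e
    rw [e]
  · exact ⟨r p, hr.mapsTo hp, h p hp⟩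

/-- The array `cnt` is a histogram of the keys, then its prefix sums. In the distribution loop, cell
`k` holds the number of smaller keys plus the number of items of key `k` already placed, which is
the rank of the next item of key `k`. -/
theorem countingSort_spec {key src dst : Arr} {s : Mem} {N : ℕ} (hn : s.reg .n = N)
    (hkc : key ≠ .cnt) (hkd : key ≠ dst) (hsc : src ≠ .cnt) (hsd : src ≠ dst) (hdc : dst ≠ .cnt)
    (hkey : ∀ p < N, s.arr key p < N) (hsrc : Set.BijOn (s.arr src) (Set.Iio N) (Set.Iio N)) :
    Spec (countingSort key src dst) s 0 (300 * (N + 1)) (fun u => ∀ i < N,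
      u.arr dst (sortRank (fun j => s.arr key (s.arr src j)) N i) = s.arr src i) := by
  set K := s.arr key with hK
  set f : ℕ → ℕ := fun j => K (s.arr src j) with hf
  refine Spec.seq_le (P := fun u => ∀ k < N, u.arr .cnt k = 0)
    ((Spec.forFrom (fun i u => ∀ k < i, u.arr .cnt k = 0) hn (Nat.zero_le _) (by decide)
      (by decide) (by decide) (by simp) ?_)) (by omega) ?_
  · intro i u _ hi hui hun _ hI
    refine Spec.of_exec (.store _ _ _ _) (by simp [Expr.cost]) ?_
    intro k hk
    simp only [Mem.setReg_arr, Mem.setArr_arr, Expr.val, hui]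
    split_ifs with h
    · rfl
    · exact hI k (by simp at h; omega)
  intro s1 f1 h1
  have n1 : s1.reg .n = N := by rw [f1.2 _ (by decide), hn]
  have k1 : s1.arr key = K := f1.1 _ (by simpa [forFrom, block, Cmd.arrs] using hkc)
  have r1 : s1.arr src = s.arr src := f1.1 _ (by simpa [forFrom, block, Cmd.arrs] using hsc)
  refine Spec.seq_le (P := fun u => ∀ k < N, u.arr .cnt k = Nat.count (fun j => K j = k) N)
    ((Spec.forFrom (fun i u => ∀ k < N, u.arr .cnt k = Nat.count (fun j => K j = k) i)
      n1 (Nat.zero_le _) (by decide) (by simp [Cmd.regs]) (by simp [Cmd.regs]) (by simpa using h1) ?_)) (by omega) ?_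
  · intro i u _ hi hui hun hfr hI
    have ku : u.arr key = K := by
      rw [hfr.1 _ (by simpa [forFrom, block, Cmd.arrs] using hkc), k1]
    refine Spec.of_exec (.store _ _ _ _) (by simp [Expr.cost]) ?_
    intro k hk
    simp only [Mem.setReg_arr, Mem.setArr_arr, Expr.val, hui, ku, Nat.count_succ]
    by_cases h : k = K i
    · simp [h, hI (K i) (hkey i hi)]
    · simp [h, hI k hk, Ne.symm h]
  intro s2 f2 h2
  have n2 : s2.reg .n = N := by rw [f2.2 _ (by simp [forFrom, block, Cmd.regs]), n1]
  have k2 : s2.arr key = K := by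
    rw [f2.1 _ (by simpa [forFrom, block, Cmd.arrs] using hkc), k1]
  have r2 : s2.arr src = s.arr src := by
    rw [f2.1 _ (by simpa [forFrom, block, Cmd.arrs] using hsc), r1]
  refine Spec.seq_le (P := fun u => u = s2.setReg .acc 0) (Spec.assign rfl) (by simp only [Expr.cost]; omega) ?_
  rintro _ - rfl
  -- In-place prefix sums: cells below `i` are converted, the others still hold the histogram, and
  -- `acc` is the sum so far.
  refine Spec.seq_le (P := fun u => ∀ k < N, u.arr .cnt k = Nat.count (fun j => K j < k) N)
    ((Spec.forFrom (fun i u => (∀ k < i, u.arr .cnt k = Nat.count (fun j => K j < k) N) ∧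
      (∀ k < N, i ≤ k → u.arr .cnt k = Nat.count (fun j => K j = k) N) ∧
      u.reg .acc = Nat.count (fun j => K j < i) N)
      (by simp [Mem.setReg_reg, n2]) (Nat.zero_le _) (by decide) (by decide) (by decide)
      (by simpa [Mem.setReg_reg, Nat.count_eq_card_filter_range] using h2) ?_).mono le_rfl le_rfl
        (fun u _ h => h.1)) (by simp only [Expr.cost]; omega) ?_
  · rintro i u - hi hui hun - ⟨hI1, hI2, hI3⟩
    refine Spec.of_exec (.seq (.assign _ _ _) (.seq (.store _ _ _ _) (.assign _ _ _)))
      (by simp [Expr.cost]) ⟨?_, ?_, ?_⟩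
    · intro k hk
      simp only [Mem.setReg_arr, Mem.setArr_arr, Expr.val, hui, Mem.setReg_reg, reduceCtorEq,
        if_false, true_and]
      split_ifs with h
      · rw [hI3, h]
      · exact hI1 k (by omega)
    · intro k hk hk'
      simp only [Mem.setReg_arr, Mem.setArr_arr, Expr.val, hui, Mem.setReg_reg, reduceCtorEq,
        if_false, true_and]
      rw [if_neg (by omega)]
      exact hI2 k hk (by omega)
    · simp only [Mem.setArr_reg, Expr.val, hui, Mem.setReg_reg, reduceCtorEq,
        if_false, if_true]
      rw [hI3, hI2 i hi le_rfl, count_lt_succ]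
  intro s3 f3 h3
  have n3 : s3.reg .n = N := by rw [f3.2 _ (by decide), Mem.setReg_reg, if_neg (by decide), n2]
  have k3 : s3.arr key = K := by
    rw [f3.1 _ (by simpa [forFrom, block, Cmd.arrs] using hkc), Mem.setReg_arr, k2]
  have r3 : s3.arr src = s.arr src := by
    rw [f3.1 _ (by simpa [forFrom, block, Cmd.arrs] using hsc), Mem.setReg_arr, r2]
  refine (Spec.forFrom (fun i u =>
      (∀ k < N, u.arr .cnt k = Nat.count (fun j => K j < k) N + Nat.count (fun j => f j = k) i) ∧
      ∀ j < i, u.arr dst (sortRank f N j) = s.arr src j)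
      n3 (Nat.zero_le _) (by decide) (by simp [block, Cmd.regs]) (by simp [block, Cmd.regs])
      (by simpa using h3) ?_).mono (Nat.zero_le _) (by simp only [Expr.cost]; omega) (fun u _ h => h.2)
  rintro i u - hi hui hun hfr ⟨hI1, hI2⟩
  have ku : u.arr key = K := by
    rw [hfr.1 _ (by simp [forFrom, block, Cmd.arrs, hkc, hkd]), k3]
  have ru : u.arr src = s.arr src := by
    rw [hfr.1 _ (by simp [forFrom, block, Cmd.arrs, hsc, hsd]), r3]
  -- The histogram counts states, the rank counts positions in `src`; they agree because `src` is a
  -- permutation.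
  have hrank : u.arr .cnt (f i) = sortRank f N i := by
    rw [hI1 _ (hkey _ (hsrc.mapsTo hi)), sortRank]
    congr 1
    exact (count_comp_of_bijOn hsrc (fun p => K p < f i)).symm
  refine Spec.of_exec (.seq (.assign _ _ _) (.seq (.store _ _ _ _) (.store _ _ _ _)))
      (by simp [Expr.cost]) ⟨?_, ?_⟩
  · intro k hk
    simp only [Mem.setReg_arr, Mem.setArr_arr, Expr.val, hui, Mem.setReg_reg, ku, ru, if_true,
      hkd, hdc.symm, Mem.setArr_reg, false_and, if_false, true_and, Nat.count_succ]
    change (if k = f i then u.arr .cnt (f i) + 1 else _) = _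
    by_cases h : k = f i
    · subst h
      simp [hI1 _ hk, add_assoc]
    · simp [h, Ne.symm h, hI1 k hk]
  · intro j hj
    simp only [Mem.setReg_arr, Mem.setArr_arr, Expr.val, hui, Mem.setReg_reg, ku, ru, if_true,
      hkd, hdc, Mem.setArr_reg, false_and, if_false, true_and]
    change (if sortRank f N j = u.arr .cnt (f i) then _ else _) = _
    rw [hrank]
    split_ifs with h
    · rw [(sortRank_bijOn f N).injOn (show j < N by omega) hi h]
    · refine hI2 j ?_
      rcases eq_or_ne j i with rfl | hne
      · exact absurd rfl h
      · omega

/-! ## One refinement step -/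

/-- The set of the values taken by `f` on `0, …, N - 1` is an initial segment of `ℕ`. -/
def DenseLabels (N : ℕ) (f : ℕ → ℕ) : Prop :=
  ∀ p < N, ∀ v < f p, ∃ q < N, f q = v

/-- A labelling without gaps is determined by the order it induces. The loop compares label arrays
rather than partitions, so its termination depends on this rigidity. -/
theorem DenseLabels.eq_of_lt_iff {N : ℕ} {f g : ℕ → ℕ} (hf : DenseLabels N f)
    (hg : DenseLabels N g) (h : ∀ p < N, ∀ q < N, (f p < f q ↔ g p < g q)) :
    ∀ p < N, f p = g p := by
  have key : ∀ v, ∀ p < N, f p = v → g p = v := by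
    intro v
    induction v using Nat.strong_induction_on with
    | _ v ih =>
      intro p hp hpv
      rcases lt_trichotomy (g p) v with hlt | heq | hgt
      · obtain ⟨q, hq, hqv⟩ := hf p hp (g p) (by omega)
        have h1 := ih (g p) hlt q hq hqv
        have h2 := h q hq p hp
        omega
      · exact heq
      · obtain ⟨q, hq, hqv⟩ := hg p hp v hgt
        have h2 := h q hq p hp
        have h3 := ih (f q) (by omega) q hq rfl
        omega
  exact fun p hp => (key _ p hp rfl).symm

/-- A count grows by at most one per step and so skips no value; this makes the new labels dense. -/
theorem exists_count_eq (P : ℕ → Prop) [DecidablePred P] :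
    ∀ k v, v < Nat.count P k → ∃ m < k, Nat.count P m = v := by
  intro k
  induction k with
  | zero => simp
  | succ k ih =>
    intro v hv
    rcases lt_or_ge v (Nat.count P k) with h | h
    · obtain ⟨m, hm, e⟩ := ih v h
      exact ⟨m, by omega, e⟩
    · rw [Nat.count_succ] at hv
      exact ⟨k, by omega, by split_ifs at hv <;> omega⟩

/-- The number of indices below `k` at which one of the sequences `x`, `y` jumps. -/
def jumpCount (x y : ℕ → ℕ) (k : ℕ) : ℕ :=
  Nat.count (fun m => ¬ (x (m + 1) = x m ∧ y (m + 1) = y m)) k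

/-- In a lexicographically sorted sequence equal pairs are contiguous, so the count increases
between two positions exactly when their pairs differ. -/
theorem jumpCount_lt_iff {x y : ℕ → ℕ} {N : ℕ}
    (h : ∀ i j, i < j → j < N → x i < x j ∨ x i = x j ∧ y i ≤ y j) {i j : ℕ}
    (hi : i < N) (hj : j < N) :
    jumpCount x y i < jumpCount x y j ↔ x i < x j ∨ x i = x j ∧ y i < y j := by
  rcases lt_or_ge j i with hji | hij
  · have h1 := h j i hji hi
    have h2 : jumpCount x y j ≤ jumpCount x y i := Nat.count_monotone _ hji.le
    omega
  · induction j, hij using Nat.le_induction with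
    | base => simp
    | succ j hij ih =>
      have ih := ih (by omega)
      have h1 := h j (j + 1) (by omega) hj
      have h2 : x i < x j ∨ x i = x j ∧ y i ≤ y j := by
        rcases eq_or_lt_of_le hij with rfl | hlt
        · exact Or.inr ⟨rfl, le_rfl⟩
        · exact h i j hlt (by omega)
      have h3 : jumpCount x y i ≤ jumpCount x y j := Nat.count_monotone _ hij
      have h4 : jumpCount x y (j + 1) = jumpCount x y j +
        if ¬ (x (j + 1) = x j ∧ y (j + 1) = y j) then 1 else 0 := Nat.count_succ _ _
      split_ifs at h4 <;> omega

/-- `g` numbers, in increasing order, the values of the pairs `(f p, f (d p))`, `p < N`. -/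
structure IsRefinement (N : ℕ) (f d g : ℕ → ℕ) : Prop where
  lt_iff : ∀ p < N, ∀ q < N, (g p < g q ↔ f p < f q ∨ f p = f q ∧ f (d p) < f (d q))
  dense : DenseLabels N g
  lt : ∀ p < N, g p < N

theorem IsRefinement.of_jumpCount {N : ℕ} {f d g σ pos : ℕ → ℕ}
    (hpos : Set.BijOn pos (Set.Iio N) (Set.Iio N)) (hσ : ∀ p < N, σ (pos p) = p)
    (hlt : ∀ p < N, ∀ q < N, pos p < pos q →
      f p < f q ∨ f p = f q ∧ f (d p) ≤ f (d q))
    (hg : ∀ k < N, g (σ k) = jumpCount (fun i => f (σ i)) (fun i => f (d (σ i))) k) :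
    IsRefinement N f d g := by
  have hg' : ∀ p < N, g p = jumpCount (fun i => f (σ i)) (fun i => f (d (σ i))) (pos p) := by
    intro p hp
    rw [← hg _ (hpos.mapsTo hp), hσ p hp]
  have hmono : ∀ i j, i < j → j < N → f (σ i) < f (σ j) ∨
      f (σ i) = f (σ j) ∧ f (d (σ i)) ≤ f (d (σ j)) := by
    intro i j hij hj
    obtain ⟨p, hp, rfl⟩ := hpos.surjOn (show i ∈ Set.Iio N from hij.trans hj)
    obtain ⟨q, hq, rfl⟩ := hpos.surjOn (show j ∈ Set.Iio N from hj)
    rw [hσ p hp, hσ q hq]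
    exact hlt p hp q hq hij
  refine ⟨fun p hp q hq => ?_, fun p hp v hv => ?_, fun p hp => ?_⟩
  · rw [hg' p hp, hg' q hq, jumpCount_lt_iff hmono (hpos.mapsTo hp) (hpos.mapsTo hq)]
    simp only [hσ p hp, hσ q hq]
  · rw [hg' p hp] at hv
    obtain ⟨m, hm, e⟩ := exists_count_eq _ _ _ hv
    have hmN : m < N := hm.trans (hpos.mapsTo hp)
    obtain ⟨q, hq, rfl⟩ := hpos.surjOn (show m ∈ Set.Iio N from hmN)
    exact ⟨q, hq, by rw [hg' q hq]; exact e⟩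
  · rw [hg' p hp]
    exact lt_of_le_of_lt (Nat.count_le _) (hpos.mapsTo hp)

theorem refine_spec {s : Mem} {N : ℕ} (hn : s.reg .n = N) (hN : 1 ≤ N)
    (hdelta : ∀ p < N, s.arr .delta p < N) (hpi : ∀ p < N, s.arr .pi p < N) :
    Spec refine s 0 (900 * (N + 1))
      (fun u => IsRefinement N (s.arr .pi) (s.arr .delta) (u.arr .piNew)) := by
  set f := s.arr .pi with hf
  set d := s.arr .delta with hd
  refine Spec.seq_le (P := fun u => ∀ k < N, u.arr .s0 k = f k ∧ u.arr .s1 k = f (d k))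
    (Spec.forFrom (fun i u => ∀ k < i, u.arr .s0 k = f k ∧ u.arr .s1 k = f (d k)) hn
      (Nat.zero_le _) (by decide) (by decide) (by decide) (by simp) ?_) (by omega) ?_
  · intro i u _ hi hui hun hfr hI
    have e1 : u.arr .pi = f := hfr.1 _ (by decide)
    have e2 : u.arr .delta = d := hfr.1 _ (by decide)
    refine Spec.of_exec (.seq (.store _ _ _ _) (.store _ _ _ _)) (by simp [Expr.cost]) ?_
    intro k hk
    simp only [Mem.setReg_arr, Mem.setArr_arr, Mem.setArr_reg, Expr.val, hui, reduceCtorEq,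
      false_and, if_false, true_and, e1, e2]
    by_cases h : k = i
    · simp [h]
    · simpa [h] using hI k (by omega)
  intro s1 f1 h1
  have n1 : s1.reg .n = N := by rw [f1.2 _ (by decide), hn]
  refine Spec.seq_le (P := fun u => ∀ k < N, u.arr .ident k = k)
    (Spec.forFrom (fun i u => ∀ k < i, u.arr .ident k = k) n1
      (Nat.zero_le _) (by decide) (by decide) (by decide) (by simp) ?_) (by omega) ?_
  · intro i u _ hi hui hun hfr hI
    refine Spec.of_exec (.store _ _ _ _) (by simp [Expr.cost]) ?_
    intro k hk
    simp only [Mem.setReg_arr, Mem.setArr_arr, Expr.val, hui, true_and]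
    split_ifs with h
    · exact h.symm
    · exact hI k (by omega)
  intro s2 f2 h2
  have n2 : s2.reg .n = N := by rw [f2.2 _ (by decide), n1]
  have a20 : ∀ k < N, s2.arr .s0 k = f k := fun k hk => by
    rw [f2.1 _ (by decide), (h1 k hk).1]
  have a21 : ∀ k < N, s2.arr .s1 k = f (d k) := fun k hk => by
    rw [f2.1 _ (by decide), (h1 k hk).2]
  have hid : Set.BijOn (s2.arr .ident) (Set.Iio N) (Set.Iio N) :=
    (Set.bijOn_id _).congr fun k hk => (h2 k hk).symm
  refine Spec.seq_le (countingSort_spec n2 (by decide) (by decide) (by decide) (by decide)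
    (by decide) (fun p hp => by rw [a21 p hp]; exact hpi _ (hdelta p hp)) hid) (by omega) ?_
  intro s3 f3 h3
  have n3 : s3.reg .n = N := by rw [f3.2 _ (by decide), n2]
  have a30 : ∀ k < N, s3.arr .s0 k = f k := fun k hk => by rw [f3.1 _ (by decide), a20 k hk]
  have a31 : ∀ k < N, s3.arr .s1 k = f (d k) := fun k hk => by rw [f3.1 _ (by decide), a21 k hk]
  set g1 : ℕ → ℕ := fun j => s2.arr .s1 (s2.arr .ident j) with hg1
  set r1 := sortRank g1 N with hr1
  have b1 : Set.BijOn r1 (Set.Iio N) (Set.Iio N) := sortRank_bijOn g1 N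
  have o3 : ∀ p < N, s3.arr .ord (r1 p) = p := fun p hp => by rw [h3 p hp, h2 p hp]
  have hord : Set.BijOn (s3.arr .ord) (Set.Iio N) (Set.Iio N) :=
    bijOn_of_leftInvOn b1 o3
  refine Spec.seq_le (countingSort_spec n3 (by decide) (by decide) (by decide) (by decide)
    (by decide) (fun p hp => by rw [a30 p hp]; exact hpi _ hp) hord) (by omega) ?_
  intro s4 f4 h4
  have n4 : s4.reg .n = N := by rw [f4.2 _ (by decide), n3]
  have a40 : ∀ k < N, s4.arr .s0 k = f k := fun k hk => by rw [f4.1 _ (by decide), a30 k hk]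
  have a41 : ∀ k < N, s4.arr .s1 k = f (d k) := fun k hk => by rw [f4.1 _ (by decide), a31 k hk]
  set g2 : ℕ → ℕ := fun j => s3.arr .s0 (s3.arr .ord j) with hg2
  set pos : ℕ → ℕ := fun p => sortRank g2 N (r1 p) with hpos
  have bpos : Set.BijOn pos (Set.Iio N) (Set.Iio N) := (sortRank_bijOn g2 N).comp b1
  set σ := s4.arr .sigma with hσ
  have oσ : ∀ p < N, σ (pos p) = p := fun p hp => by rw [h4 _ (b1.mapsTo hp), o3 p hp]
  -- Radix sort: the second pass orders by the first component and, being stable, breaks ties by the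
  -- rank from the first pass, which orders by the second component.
  have hlt : ∀ p < N, ∀ q < N, pos p < pos q → f p < f q ∨ f p = f q ∧ f (d p) ≤ f (d q) := by
    intro p hp q hq hpq
    have e1 := (sortRank_lt_iff g2 (b1.mapsTo hp) (b1.mapsTo hq)).1 hpq
    have e2 : r1 p < r1 q ↔ _ := sortRank_lt_iff g1 hp hq
    simp only [hg2, o3 p hp, o3 q hq, a30 p hp, a30 q hq] at e1
    simp only [hg1, h2 p hp, h2 q hq, a21 p hp, a21 q hq] at e2
    omega
  have bσ : Set.BijOn σ (Set.Iio N) (Set.Iio N) := bijOn_of_leftInvOn bpos oσ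
  set J := jumpCount (fun i => f (σ i)) (fun i => f (d (σ i))) with hJ
  refine Spec.seq_le (P := fun u => u = s4.setReg .label 0) (Spec.assign rfl)
    (by simp only [Expr.cost]; omega) ?_
  rintro _ - rfl
  refine Spec.seq_le (P := fun u => u = (s4.setReg .label 0).setReg .q (σ 0)) (Spec.assign rfl)
    (by simp only [Expr.cost]; omega) ?_
  rintro _ - rfl
  refine Spec.seq_le (P := fun u => u =
    ((s4.setReg .label 0).setReg .q (σ 0)).setArr .piNew (σ 0) 0) (Spec.store ?_)
    (by simp only [Expr.cost]; omega) ?_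
  · simp [Expr.val, Mem.setReg_reg]
  rintro _ - rfl
  -- The loop starts at 1, so `i - 1` is a genuine index: the sorted position treated last.
  refine (Spec.forFrom (fun i u => u.reg .label = J (i - 1) ∧ u.reg .q = σ (i - 1) ∧
    ∀ k < i, u.arr .piNew (σ k) = J k) (by simp [Mem.setReg_reg, n4]) hN (by decide) (by decide)
    (by decide) ?_ ?_).mono (Nat.zero_le _) (by simp only [Expr.cost]; omega)
      (fun u _ h => IsRefinement.of_jumpCount bpos oσ hlt h.2.2)
  · refine ⟨by simp [Mem.setReg_reg, hJ, jumpCount], by simp [Mem.setReg_reg], ?_⟩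
    intro k hk
    obtain rfl : k = 0 := by omega
    simp [Mem.setArr_arr, hJ, jumpCount]
  · rintro i u hi1 hi hui hun hfr ⟨hl, hq, hI⟩
    obtain ⟨m, rfl⟩ : ∃ m, i = m + 1 := ⟨i - 1, by omega⟩
    simp only [Nat.add_sub_cancel] at hl hq ⊢
    have u0 : ∀ k < N, u.arr .s0 k = f k := fun k hk => by
      rw [hfr.1 _ (by decide)]; exact a40 k hk
    have u1 : ∀ k < N, u.arr .s1 k = f (d k) := fun k hk => by
      rw [hfr.1 _ (by decide)]; exact a41 k hk
    have uσ : u.arr .sigma = σ := hfr.1 _ (by decide)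
    have Jsucc : J (m + 1) = J m + if ¬ (f (σ (m + 1)) = f (σ m) ∧
      f (d (σ (m + 1))) = f (d (σ m))) then 1 else 0 := Nat.count_succ _ _
    have c0 := u0 _ (bσ.mapsTo hi)
    have c0' := u0 _ (bσ.mapsTo (show m < N by omega))
    have c1 := u1 _ (bσ.mapsTo hi)
    have c1' := u1 _ (bσ.mapsTo (show m < N by omega))
    refine Spec.seq_le (P := fun v => v = u.setReg .p (σ (m + 1))) (Spec.assign ?_)
      (by simp [Expr.cost]) ?_
    · simp [Expr.val, hui, uσ]
    rintro _ - rfl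
    refine Spec.seq_le (P := fun v => v.reg .label = J (m + 1)) (Spec.ite (l := 0) (h := 20) (fun hb => ?_)
      (fun hb => ?_)) (by simp [Test.cost, Expr.cost]) ?_
    · simp [Test.holds, Expr.val, Mem.setReg_reg, hq, c0, c0'] at hb
      refine (Spec.ite (h := 10) (fun hb' => ?_) (fun hb' => ?_)).mono le_rfl
        (by simp [Test.cost, Expr.cost]) (fun _ _ h => h)
      · simp [Test.holds, Expr.val, Mem.setReg_reg, hq, c1, c1'] at hb'
        refine Spec.of_exec (.skip _) (by simp) ?_
        simp [Mem.setReg_reg, hl, Jsucc, hb, hb']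
      · simp [Test.holds, Expr.val, Mem.setReg_reg, hq, c1, c1'] at hb'
        refine Spec.of_exec (.assign _ _ _) (by simp [Expr.cost]) ?_
        simp [Mem.setReg_reg, hl, Jsucc, hb', Expr.val]
    · simp [Test.holds, Expr.val, Mem.setReg_reg, hq, c0, c0'] at hb
      refine Spec.of_exec (.assign _ _ _) (by simp [Expr.cost]) ?_
      simp [Mem.setReg_reg, hl, Jsucc, hb, Expr.val]
    intro v hv hvl
    have vp : v.reg .p = σ (m + 1) := by rw [hv.2 _ (by decide)]; simp
    have va : v.arr .piNew = u.arr .piNew := hv.1 _ (by decide)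
    refine Spec.of_exec (.seq (.store _ _ _ _) (.assign _ _ _))
      (by simp [Expr.cost, Test.cost]) ⟨?_, ?_, ?_⟩
    · simp [Mem.setReg_reg, hvl]
    · simp [Mem.setReg_reg, Expr.val, vp]
    · intro k hk
      simp only [Mem.setReg_arr, Mem.setArr_arr, Expr.val, vp, hvl, true_and, va]
      split_ifs with h
      · rw [bσ.injOn (show k < N by omega) hi h]
      · refine hI k ?_
        rcases eq_or_ne k (m + 1) with rfl | hne
        · exact absurd rfl h
        · omega

/-! ## Moore's equivalences and the running time of the main loop -/

/-- The states `p` and `q` are not distinguished by words of length less than `k`. -/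
def Agree {α : Type*} (d : α → α) (F : Set α) (k : ℕ) (p q : α) : Prop :=
  ∀ i < k, (d^[i] p ∈ F ↔ d^[i] q ∈ F)

/-- Words of length `k` do not distinguish more states than shorter words do. -/
def Stable {α : Type*} (d : α → α) (F : Set α) (k : ℕ) : Prop :=
  ∀ p q, Agree d F k p q → Agree d F (k + 1) p q

/-- A word of length at most `k` is empty or a letter followed by a word of length less than `k`; `1
≤ k` lets the first conjunct cover the empty word. -/
theorem agree_succ_iff {α : Type*} {d : α → α} {F : Set α} {k : ℕ} (hk : 1 ≤ k) {p q : α} :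
    Agree d F (k + 1) p q ↔ Agree d F k p q ∧ Agree d F k (d p) (d q) := by
  constructor
  · exact fun h => ⟨fun i hi => h i (by omega), fun i hi => h (i + 1) (by omega)⟩
  · rintro ⟨h1, h2⟩ i hi
    rcases i with _ | i
    · exact h1 0 (by omega)
    · exact h2 i (by omega)

/-- `f` is a numbering by `0, 1, …` of the classes of the equivalence `Agree d F k`. -/
structure Represents {n : ℕ} (d : Fin n → Fin n) (F : Set (Fin n)) (k : ℕ) (f : ℕ → ℕ) :
    Prop where
  dense : DenseLabels n f
  lt : ∀ p < n, f p < n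
  eq_iff : ∀ p q : Fin n, f p = f q ↔ Agree d F k p q

theorem Represents.refinement {n : ℕ} {d : Fin n → Fin n} {F : Set (Fin n)} {k : ℕ} (hk : 1 ≤ k)
    {f g δ : ℕ → ℕ} (hf : Represents d F k f) (hδ : ∀ p : Fin n, δ p = d p)
    (hg : IsRefinement n f δ g) : Represents d F (k + 1) g := by
  refine ⟨hg.dense, hg.lt, fun p q => ?_⟩
  have h1 := hg.lt_iff p p.2 q q.2
  have h2 := hg.lt_iff q q.2 p p.2
  rw [agree_succ_iff hk, ← hf.eq_iff, ← hf.eq_iff, ← hδ, ← hδ]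
  omega

/-- Pairs are compared first by the old label, so if no class splits the new labels induce the old
order, and density makes the two arrays identical. -/
theorem Represents.eq_refinement_iff {n : ℕ} {d : Fin n → Fin n} {F : Set (Fin n)} {k : ℕ}
    (hk : 1 ≤ k) {f g δ : ℕ → ℕ} (hf : Represents d F k f) (hδ : ∀ p : Fin n, δ p = d p)
    (hg : IsRefinement n f δ g) : (∀ p < n, f p = g p) ↔ Stable d F k := by
  have hg' := hf.refinement hk hδ hg
  constructor
  · intro h p q hpq
    rw [← hg'.eq_iff, ← h p p.2, ← h q q.2, hf.eq_iff]
    exact hpq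
  · intro h
    refine hf.dense.eq_of_lt_iff hg.dense fun p hp q hq => ?_
    have h1 := hg.lt_iff p hp q hq
    have h2 : f p = f q → g p = g q := fun e =>
      (hg'.eq_iff ⟨p, hp⟩ ⟨q, hq⟩).2 (h _ _ ((hf.eq_iff ⟨p, hp⟩ ⟨q, hq⟩).1 e))
    omega

/-- The body of the main loop. -/
def mainBody : Cmd :=
  block [
    forFrom .p 0 (.store .pi (.reg .p) (.get .piNew (.reg .p))),
    refine,
    .assign .changed (.const 0),
    forFrom .p 0 (.ite (.eq (.get .pi (.reg .p)) (.get .piNew (.reg .p)))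
      .skip (.assign .changed (.const 1)))]

theorem mainBody_spec {n : ℕ} (hn1 : 1 ≤ n) {d : Fin n → Fin n} {F : Set (Fin n)} {k : ℕ}
    (hk : 1 ≤ k) {s : Mem} (hn : s.reg .n = n) (hd : ∀ p : Fin n, s.arr .delta p = d p)
    (hrep : Represents d F k (s.arr .piNew)) :
    Spec mainBody s n (1100 * (n + 1)) (fun u => u.reg .n = n ∧
      (∀ p : Fin n, u.arr .delta p = d p) ∧ Represents d F (k + 1) (u.arr .piNew) ∧
      (u.reg .changed = 1 ↔ ¬ Stable d F k)) := by
  -- The lower bound `n` comes from the copying loop alone.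
  suffices H : Spec mainBody s (n - 0 + 0) (60 * (n + 1) + 1040 * (n + 1)) _ from
    H.mono (by omega) (by omega) (fun _ _ h => h)
  refine Spec.seq (P := fun u => ∀ j < n, u.arr .pi j = s.arr .piNew j)
    (Spec.forFrom (fun i u => ∀ j < i, u.arr .pi j = s.arr .piNew j) hn
      (Nat.zero_le _) (by decide) (by decide) (by decide) (by simp) ?_) ?_
  · intro i u _ hi hui hun hfr hI
    have e1 : u.arr .piNew = s.arr .piNew := hfr.1 _ (by decide)
    refine Spec.of_exec (.store _ _ _ _) (by simp [Expr.cost]) ?_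
    intro j hj
    simp only [Mem.setReg_arr, Mem.setArr_arr, Expr.val, hui, true_and, e1]
    split_ifs with h
    · rw [h]
    · exact hI j (by omega)
  intro s1 f1 h1
  have n1 : s1.reg .n = n := by rw [f1.2 _ (by decide), hn]
  have d1 : ∀ p : Fin n, s1.arr .delta p = d p := fun p => by rw [f1.1 _ (by decide), hd]
  have rep1 : Represents d F k (s1.arr .pi) := by
    refine ⟨fun p hp v hv => ?_, fun p hp => ?_, fun p q => ?_⟩
    · rw [h1 p hp] at hv
      obtain ⟨q, hq, e⟩ := hrep.dense p hp v hv
      exact ⟨q, hq, by rw [h1 q hq, e]⟩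
    · rw [h1 p hp]; exact hrep.lt p hp
    · rw [h1 p p.2, h1 q q.2]; exact hrep.eq_iff p q
  refine Spec.seq_le (refine_spec n1 hn1
    (fun p hp => by rw [d1 ⟨p, hp⟩]; exact (d ⟨p, hp⟩).2) rep1.lt) (by omega) ?_
  intro s2 f2 h2
  have n2 : s2.reg .n = n := by rw [f2.2 _ (by decide), n1]
  have d2 : s2.arr .delta = s1.arr .delta := f2.1 _ (by decide)
  have p2 : s2.arr .pi = s1.arr .pi := f2.1 _ (by decide)
  refine Spec.seq_le (P := fun u => u = s2.setReg .changed 0) (Spec.assign rfl)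
    (by simp only [Expr.cost]; omega) ?_
  rintro _ - rfl
  refine (Spec.forFrom (N := n) (fun i u =>
      (u.reg .changed = 1 ↔ ∃ j < i, s2.arr .pi j ≠ s2.arr .piNew j))
      (by simp [Mem.setReg_reg, n2]) (Nat.zero_le _) (by decide) (by decide) (by decide)
      (by simp [Mem.setReg_reg]) ?_).mono (Nat.zero_le _) (by simp only [Expr.cost]; omega) ?_
  · intro i u _ hi hui hun hfr hI
    have e1 : u.arr .piNew = s2.arr .piNew := hfr.1 _ (by decide)
    have e2 : u.arr .pi = s2.arr .pi := hfr.1 _ (by decide)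
    refine (Spec.ite (h := 10) (fun hb => ?_) (fun hb => ?_)).mono le_rfl
      (by simp [Test.cost, Expr.cost]) (fun _ _ h => h)
    · simp only [Test.holds, Expr.val, hui, e1, e2] at hb
      refine Spec.of_exec (.skip _) (by simp) ?_
      simp only [Mem.setReg_reg, reduceCtorEq, if_false, hI]
      refine ⟨fun ⟨j, hj, h⟩ => ⟨j, by omega, h⟩, fun ⟨j, hj, h⟩ => ⟨j, ?_, h⟩⟩
      rcases eq_or_ne j i with rfl | hne
      · exact absurd hb h
      · omega
    · simp only [Test.holds, Expr.val, hui, e1, e2] at hb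
      refine Spec.of_exec (.assign _ _ _) (by simp [Expr.cost]) ?_
      simp only [Mem.setReg_reg, reduceCtorEq, if_false, if_true, Expr.val, true_iff]
      exact ⟨i, by omega, hb⟩
  · intro u fu hu
    have up : u.arr .piNew = s2.arr .piNew := fu.1 _ (by decide)
    have ud : u.arr .delta = s1.arr .delta := by rw [fu.1 _ (by decide), Mem.setReg_arr, d2]
    refine ⟨?_, fun p => by rw [ud, d1], ?_, ?_⟩
    · rw [fu.2 _ (by decide)]; simp [Mem.setReg_reg, n2]
    · rw [up]; exact rep1.refinement hk d1 h2
    · rw [hu, ← rep1.eq_refinement_iff hk d1 h2, p2]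
      push Not
      rfl

/-- A round entered at level `k` signals a change iff `k` is not stable, so by minimality of `T` the
rounds are those of levels `k, …, T`, which are `m + 1` in number. -/
theorem mainLoop_while_spec {n : ℕ} (hn1 : 1 ≤ n) {d : Fin n → Fin n} {F : Set (Fin n)} {T : ℕ}
    (hT : Stable d F T) (hmin : ∀ k < T, ¬ Stable d F k) :
    ∀ (m k : ℕ) (s : Mem), k + m = T → 1 ≤ k → s.reg .changed = 1 → s.reg .n = n →
      (∀ p : Fin n, s.arr .delta p = d p) → Represents d F k (s.arr .piNew) →
      Spec (.while (.eq (.reg .changed) (.const 1)) mainBody) s (n * (m + 1))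
        (1110 * (n + 1) * (m + 1)) (fun u => u.reg .n = n) := by
  intro m
  induction m with
  | zero =>
    intro k s hkm hk hc hn hd hrep
    obtain ⟨t, u, e, h1, h2, hun, -, -, huc⟩ := mainBody_spec hn1 hk hn hd hrep
    have : ¬ (Test.eq (.reg .changed) (.const 1)).holds u := by
      simp only [Test.holds, Expr.val, huc]
      exact not_not.2 (by simpa [← hkm] using hT)
    refine ⟨_, u, .whileTrue (by simpa [Test.holds, Expr.val] using hc) e (.whileFalse this),
      by omega, ?_, hun⟩
    simp only [Test.cost, Expr.cost]; omega
  | succ m ih =>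
    intro k s hkm hk hc hn hd hrep
    obtain ⟨t, u, e, h1, h2, hun, hud, hur, huc⟩ := mainBody_spec hn1 hk hn hd hrep
    obtain ⟨t', u', e', h1', h2', hun'⟩ := ih (k + 1) u (by omega) (by omega)
      (huc.2 (hmin k (by omega))) hun hud hur
    refine ⟨_, u', .whileTrue (by simpa [Test.holds, Expr.val] using hc) e e', ?_, ?_, hun'⟩
    · rw [mul_add]; omega
    · rw [mul_add _ (m + 1)]
      simp only [Test.cost, Expr.cost]; omega

theorem quotient_spec {n : ℕ} {s : Mem} (hn : s.reg .n = n) :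
    Spec quotient s 0 (70 * (n + 1)) (fun _ => True) := by
  refine Spec.seq_le (P := fun _ => True) (Spec.assign trivial)
    (by simp only [Expr.cost]; omega) fun s1 f1 _ => ?_
  refine Spec.seq_le (P := fun _ => True) (Spec.assign trivial)
    (by simp only [Expr.cost]; omega) fun s2 f2 _ => ?_
  refine (Spec.forFrom (fun _ _ => True) (N := n) ?_ (Nat.zero_le _) (by decide) (by decide)
    (by decide) trivial fun i u _ _ _ _ _ _ => ?_).mono (Nat.zero_le _)
      (by simp only [Expr.cost]; omega) (fun _ _ h => h)
  · rw [f2.2 _ (by decide), f1.2 _ (by decide), hn]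
  · exact Spec.of_exec (.seq (.store _ _ _ _) (.store _ _ _ _)) (by simp [Expr.cost]) trivial

theorem returnTrivial_spec (b : ℕ) (s : Mem) : Spec (returnTrivial b) s 0 20 (fun _ => True) :=
  Spec.of_exec (.seq (.assign _ _ _) (.seq (.assign _ _ _) (.seq (.store _ _ _ _)
    (.store _ _ _ _)))) (by simp [Expr.cost]) trivial

/-- If `F` is empty or full, level 0 is already stable, so `T = 0` and the lower bound is void.
Otherwise `T ≥ 1`, and the loop, entered at level 1, makes `T` rounds. -/
theorem exists_haltsIn {n : ℕ} (M : UnaryDFA n) {T : ℕ}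
    (hT : Stable (fun p => M.step p ()) M.accept T)
    (hmin : ∀ k < T, ¬ Stable (fun p => M.step p ()) M.accept k) :
    ∃ t, HaltsIn M t ∧ n * T ≤ t ∧ t ≤ 2000 * (n + 1) * (T + 1) := by
  classical
  set d : Fin n → Fin n := fun p => M.step p () with hd
  set F := M.accept with hF
  set s := inputMem M with hs
  have hfin : ∀ p : Fin n, s.arr .fin p = if p ∈ F then 1 else 0 := by
    intro p
    simp [hs, inputMem, hF]
  have hdelta : ∀ p : Fin n, s.arr .delta p = d p := by
    intro p
    simp [hs, inputMem, hd]
  let P : ℕ → Prop := fun j => ∃ h : j < n, (⟨j, h⟩ : Fin n) ∈ F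
  have hsn : s.reg .n = n := rfl
  suffices H : Spec mooreProgram s (n * T) (2000 * (n + 1) * (T + 1)) (fun _ => True) by
    obtain ⟨t, u, e, h1, h2, -⟩ := H
    exact ⟨t, ⟨u, e⟩, h1, h2⟩
  suffices H : Spec mooreProgram s (0 + ((n - 0) + n * T))
      (2 + (60 * (n + 1) + (3 + (3 + (60 * (n + 1) + (2 + 1110 * (n + 1) * (T + 1)
        + 70 * (n + 1))))))) (fun _ => True) by
    refine H.mono (by omega) ?_ (fun _ _ h => h)
    have e1 : 2000 * (n + 1) * (T + 1) = 2000 * ((n + 1) * (T + 1)) := by ring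
    have e2 : 1110 * (n + 1) * (T + 1) = 1110 * ((n + 1) * (T + 1)) := by ring
    have e3 : n + 1 ≤ (n + 1) * (T + 1) := Nat.le_mul_of_pos_right _ (by omega)
    omega
  refine Spec.seq (P := fun u => u = s.setReg .count 0) (Spec.assign rfl) ?_
  rintro _ - rfl
  refine Spec.seq (P := fun u => u.reg .count = Nat.count P n)
    (Spec.forFrom (fun i u => u.reg .count = Nat.count P i)
      (by simp [Mem.setReg_reg, hsn]) (Nat.zero_le _) (by decide) (by decide) (by decide)
      (by simp [Mem.setReg_reg]) ?_) ?_
  · intro i u _ hi hui hun hfr hI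
    have e1 : u.arr .fin = s.arr .fin := hfr.1 _ (by decide)
    refine Spec.of_exec (.assign _ _ _) (by simp [Expr.cost]) ?_
    have := hfin ⟨i, hi⟩
    simp only at this
    simp [Mem.setReg_reg, Expr.val, hui, e1, hI, Nat.count_succ, this, P, hi]
  intro s1 f1 h1
  have n1 : s1.reg .n = n := by
    rw [f1.2 _ (by decide), Mem.setReg_reg, if_neg (by decide), hsn]
  have d1 : ∀ p : Fin n, s1.arr .delta p = d p := fun p => by
    rw [f1.1 _ (by decide), Mem.setReg_arr, hdelta]
  have fin1 : ∀ p : Fin n, s1.arr .fin p = if p ∈ F then 1 else 0 := fun p => by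
    rw [f1.1 _ (by decide), Mem.setReg_arr, hfin]
  have hzero : Stable d F 0 → T = 0 := fun h => by
    by_contra hne
    exact hmin 0 (by omega) h
  refine Spec.ite (b := .eq (.reg .count) (.const 0)) (fun hb => ?_) (fun hb => ?_)
  · simp only [Test.holds, Expr.val, h1, Nat.count_iff_forall_not] at hb
    have : T = 0 := hzero fun p q _ i _ => by
      have h1 : d^[i] p ∉ F := fun h => hb _ (d^[i] p).2 ⟨(d^[i] p).2, h⟩
      have h2 : d^[i] q ∉ F := fun h => hb _ (d^[i] q).2 ⟨(d^[i] q).2, h⟩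
      tauto
    exact (returnTrivial_spec 0 s1).mono (by simp [this]) (by omega) (fun _ _ h => h)
  refine Spec.ite (b := .eq (.reg .count) (.reg .n)) (fun hb' => ?_) (fun hb' => ?_)
  · simp only [Test.holds, Expr.val, h1, n1, Nat.count_iff_forall] at hb'
    have : T = 0 := hzero fun p q _ i _ => by
      have h1 : d^[i] p ∈ F := (hb' _ (d^[i] p).2).2
      have h2 : d^[i] q ∈ F := (hb' _ (d^[i] q).2).2
      tauto
    exact (returnTrivial_spec 1 s1).mono (by simp [this]) (by omega) (fun _ _ h => h)
  simp only [Test.holds, Expr.val, h1, n1, Nat.count_iff_forall_not, Nat.count_iff_forall] at hb hb'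
  push Not at hb hb'
  obtain ⟨x, -, ⟨hx, hxF⟩⟩ := hb
  obtain ⟨y, hy, hyF⟩ := hb'
  have hyF : (⟨y, hy⟩ : Fin n) ∉ F := fun h => hyF ⟨hy, h⟩
  have hn2 : 2 ≤ n := by
    by_contra hlt
    have : Subsingleton (Fin n) := by
      rw [Fin.subsingleton_iff_le_one]; omega
    exact hyF (Subsingleton.elim _ (⟨y, hy⟩ : Fin n) ▸ hxF)
  have hT1 : 1 ≤ T := by
    by_contra hlt
    obtain rfl : T = 0 := by omega
    have := hT ⟨x, hx⟩ ⟨y, hy⟩ (fun i hi => absurd hi (Nat.not_lt_zero i)) 0 (by omega)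
    exact hyF (this.1 hxF)
  refine (Spec.seq (l := 0) (l' := n * T) (P := fun u => ∀ j < n, u.arr .piNew j = s1.arr .fin j)
    ((Spec.forFrom (fun i u => ∀ j < i, u.arr .piNew j = s1.arr .fin j) n1
      (Nat.zero_le _) (by decide) (by decide) (by decide) (by simp) ?_).mono (Nat.zero_le _) le_rfl
        (fun _ _ h => h)) ?_).mono (by omega) le_rfl (fun _ _ h => h)
  · intro i u _ hi hui hun hfr hI
    have e1 : u.arr .fin = s1.arr .fin := hfr.1 _ (by decide)
    refine Spec.of_exec (.store _ _ _ _) (by simp [Expr.cost]) ?_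
    intro j hj
    simp only [Mem.setReg_arr, Mem.setArr_arr, Expr.val, hui, true_and, e1]
    split_ifs with h
    · rw [h]
    · exact hI j (by omega)
  intro s2 f2 h2
  have n2 : s2.reg .n = n := by rw [f2.2 _ (by decide), n1]
  have d2 : ∀ p : Fin n, s2.arr .delta p = d p := fun p => by rw [f2.1 _ (by decide), d1]
  have fin2 : ∀ p : Fin n, s2.arr .piNew p = if p ∈ F then 1 else 0 := fun p => by
    rw [h2 p p.2, fin1]
  have rep2 : Represents d F 1 (s2.arr .piNew) := by
    -- The only value below a label is 0, attained at the non-final state `y`.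
    refine ⟨fun p hp v hv => ⟨y, hy, ?_⟩, fun p hp => ?_, fun p q => ?_⟩
    · have := fin2 ⟨p, hp⟩
      have e := fin2 ⟨y, hy⟩
      simp only [hyF, if_false] at this e
      split_ifs at this <;> omega
    · have := fin2 ⟨p, hp⟩
      simp only at this
      split_ifs at this <;> omega
    · rw [fin2, fin2]
      constructor
      · intro h i hi
        obtain rfl : i = 0 := by omega
        simp only [Function.iterate_zero, id_eq]
        split_ifs at h <;> tauto
      · intro h
        have := h 0 (by omega)
        simp only [Function.iterate_zero, id_eq] at this
        simp only [this]
  have hloop : Spec mainLoop s2 (n * T) (2 + 1110 * (n + 1) * (T + 1)) (fun u => u.reg .n = n) := by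
    suffices H : Spec mainLoop s2 (0 + n * (T - 1 + 1)) (2 + 1110 * (n + 1) * (T - 1 + 1))
        (fun u => u.reg .n = n) by
      rw [Nat.sub_add_cancel hT1] at H
      refine H.mono (by omega) ?_ (fun _ _ h => h)
      gcongr
      omega
    refine Spec.seq (P := fun u => u = s2.setReg .changed 1) (Spec.assign rfl) ?_
    rintro _ - rfl
    exact mainLoop_while_spec (by omega) hT hmin (T - 1) 1 _ (by omega) le_rfl (by simp)
      (by simp [Mem.setReg_reg, n2]) d2 rep2
  exact (hloop.seq fun u _ hu => quotient_spec hu).mono (by omega) (by omega) (fun _ _ h => h)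

/-! ## Counting sets of final states -/

theorem Agree.symm {α : Type*} {d : α → α} {F : Set α} {k : ℕ} {p q : α} (h : Agree d F k p q) :
    Agree d F k q p := fun i hi => (h i hi).symm

theorem Agree.trans {α : Type*} {d : α → α} {F : Set α} {k : ℕ} {p q r : α}
    (h : Agree d F k p q) (h' : Agree d F k q r) : Agree d F k p r :=
  fun i hi => (h i hi).trans (h' i hi)

theorem Stable.succ {α : Type*} {d : α → α} {F : Set α} {k : ℕ} (h : Stable d F k) :
    Stable d F (k + 1) := by
  intro p q hpq
  rw [agree_succ_iff (by omega)]
  exact ⟨hpq, h _ _ fun i hi => hpq (i + 1) (by omega)⟩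

theorem Stable.mono {α : Type*} {d : α → α} {F : Set α} {k m : ℕ} (h : Stable d F k)
    (hkm : k ≤ m) : Stable d F m := by
  induction m, hkm using Nat.le_induction with
  | base => exact h
  | succ m _ ih => exact ih.succ

open Classical in
/-- If `p` and `q` can be distinguished by a word of length `k` but by no shorter word for some set
of final states, then the constraints `Agree d F k p q` on `F` are independent. -/
theorem card_agree_mul_two_pow_le {α : Type*} [Fintype α] (d : α → α) (p q : α) {k : ℕ}
    {F₀ : Set α} (h₀ : Agree d F₀ k p q) (h₁ : ¬ Agree d F₀ (k + 1) p q) :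
    Finset.card {F : Set α | Agree d F k p q} * 2 ^ k ≤ 2 ^ Fintype.card α := by
  have hk : ¬ (d^[k] p ∈ F₀ ↔ d^[k] q ∈ F₀) := fun h => h₁ fun i hi => by
    rcases Nat.lt_succ_iff_lt_or_eq.1 hi with hi | rfl
    · exact h₀ i hi
    · exact h
  have half : ∀ i < k, 2 * Finset.card {F : Set α | Agree d F (i + 1) p q}
      ≤ Finset.card {F : Set α | Agree d F i p q} := by
    intro i hi
    -- This set separates `d^[i] p` from `d^[i] q`, which `F₀` tells apart after `k - i` further
    -- steps, but no earlier pair `d^[j] p`, `d^[j] q`, which agrees long enough. Toggling `F` on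
    -- `C` thus breaks condition `i` and keeps the previous ones, so condition `i` holds for at most
    -- half of the sets satisfying them.
    let C : Set α := {z | Agree d F₀ (k + 1 - i) (d^[i] p) z}
    have hpC : d^[i] p ∈ C := fun _ _ => Iff.rfl
    have hqC : d^[i] q ∉ C := fun h => by
      have := h (k - i) (by omega)
      rw [← Function.iterate_add_apply, ← Function.iterate_add_apply,
        Nat.sub_add_cancel hi.le] at this
      exact hk this
    have hjC : ∀ j < i, (d^[j] p ∈ C ↔ d^[j] q ∈ C) := by
      intro j hj
      have e : Agree d F₀ (k + 1 - i) (d^[j] p) (d^[j] q) := fun m hm => by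
        rw [← Function.iterate_add_apply, ← Function.iterate_add_apply]
        exact h₀ _ (by omega)
      exact ⟨fun h => h.trans e, fun h => h.trans e.symm⟩
    have hle : Finset.card {F : Set α | Agree d F (i + 1) p q}
        ≤ Finset.card {F : Set α | Agree d F i p q ∧ ¬ Agree d F (i + 1) p q} := by
      refine Finset.card_le_card_of_injOn (fun F => symmDiff F C) (fun F hF => ?_)
        (fun F _ F' _ h => symmDiff_left_injective C h)
      simp only [Finset.coe_filter, Finset.mem_univ, true_and, Set.mem_ofPred_eq] at hF ⊢
      refine ⟨fun j hj => ?_, fun h => ?_⟩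
      · have h1 := hF j (by omega)
        have h2 := hjC j hj
        simp only [Set.mem_symmDiff]
        tauto
      · have h1 := hF i (by omega)
        have h2 := h i (by omega)
        simp only [Set.mem_symmDiff] at h2
        tauto
    have hsplit := Finset.card_filter_add_card_filter_not
      (s := ({F : Set α | Agree d F i p q} : Finset (Set α)))
      (fun F => Agree d F (i + 1) p q)
    rw [Finset.filter_filter, Finset.filter_filter] at hsplit
    have hsub : ∀ F : Set α, (Agree d F i p q ∧ Agree d F (i + 1) p q) ↔
        Agree d F (i + 1) p q :=
      fun F => ⟨fun h => h.2, fun h => ⟨fun j hj => h j (by omega), h⟩⟩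
    simp only [hsub] at hsplit
    omega
  have main : ∀ i ≤ k, Finset.card {F : Set α | Agree d F i p q} * 2 ^ i
      ≤ 2 ^ Fintype.card α := by
    intro i
    induction i with
    | zero =>
      intro _
      refine (Nat.mul_le_mul_right _ (Finset.card_le_univ _)).trans ?_
      simp
    | succ i ih =>
      intro hi
      refine le_trans ?_ (ih (by omega))
      have := Nat.mul_le_mul_right (2 ^ i) (half i (by omega))
      rw [pow_succ]
      linarith
  exact main k le_rfl

-- Union bound over the pairs that `F` first separates at length `k`; a pair for which no set does
-- so contributes nothing.
open Classical in
theorem card_not_stable_mul_two_pow_le {α : Type*} [Fintype α] (d : α → α) (k : ℕ) :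
    2 ^ k * Finset.card {F : Set α | ¬ Stable d F k}
      ≤ Fintype.card α ^ 2 * 2 ^ Fintype.card α := by
  have hsub : ({F : Set α | ¬ Stable d F k} : Finset (Set α)) ⊆
      (Finset.univ : Finset (α × α)).biUnion fun x =>
        {F : Set α | Agree d F k x.1 x.2 ∧ ¬ Agree d F (k + 1) x.1 x.2} := by
    intro F hF
    have hF : ¬ Stable d F k := (Finset.mem_filter.1 hF).2
    unfold Stable at hF
    push Not at hF
    obtain ⟨p, q, h⟩ := hF
    simp only [Finset.mem_biUnion, Finset.mem_univ, Finset.mem_filter, true_and]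
    exact ⟨(p, q), h⟩
  calc 2 ^ k * Finset.card {F : Set α | ¬ Stable d F k}
      ≤ 2 ^ k * ∑ x : α × α,
          Finset.card {F : Set α | Agree d F k x.1 x.2 ∧ ¬ Agree d F (k + 1) x.1 x.2} :=
        Nat.mul_le_mul_left _ ((Finset.card_le_card hsub).trans Finset.card_biUnion_le)
    _ = ∑ x : α × α, 2 ^ k *
          Finset.card {F : Set α | Agree d F k x.1 x.2 ∧ ¬ Agree d F (k + 1) x.1 x.2} :=
        Finset.mul_sum _ _ _
    _ ≤ ∑ _x : α × α, 2 ^ Fintype.card α := by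
        refine Finset.sum_le_sum fun x _ => ?_
        by_cases hx : ∃ F₀ : Set α, Agree d F₀ k x.1 x.2 ∧ ¬ Agree d F₀ (k + 1) x.1 x.2
        · obtain ⟨F₀, h₀, h₁⟩ := hx
          refine le_trans ?_ (card_agree_mul_two_pow_le d x.1 x.2 h₀ h₁)
          rw [mul_comm]
          refine Nat.mul_le_mul_right _ (Finset.card_le_card fun F hF => ?_)
          simp only [Finset.mem_filter, Finset.mem_univ, true_and] at hF ⊢
          exact hF.1
        · rw [Finset.filter_false_of_mem fun F _ h => hx ⟨F, h⟩]
          simp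
    _ = Fintype.card α ^ 2 * 2 ^ Fintype.card α := by
        simp [sq]

/-- A single failure at this level would, by the independence count, give `2 ^ (n + 1) ≤ 2 ^ n`,
where `n` is the cardinality. The bound is crude but suffices for the rare bad sets. -/
theorem stable_card_succ {α : Type*} [Fintype α] (d : α → α) (F : Set α) :
    Stable d F (Fintype.card α + 1) := by
  classical
  intro p q h₀
  by_contra h₁
  have h := card_agree_mul_two_pow_le d p q h₀ h₁
  have hpos : 0 < Finset.card {F : Set α | Agree d F (Fintype.card α + 1) p q} :=
    Finset.card_pos.2 ⟨F, by simpa using h₀⟩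
  have : 2 ^ (Fintype.card α + 1) ≤ 2 ^ Fintype.card α :=
    (Nat.le_mul_of_pos_left _ hpos).trans h
  rw [Nat.pow_le_pow_iff_right (by omega)] at this
  omega

open Classical in
/-- When the orbit of `s` is everything, a set of final states which is stable at `k` is determined
by its first `k` values along the orbit and the rule giving each value from the `k` previous
ones. -/
theorem card_stable_le {α : Type*} [Fintype α] (d : α → α) (s : α) (hs : ∀ p, ∃ i, d^[i] s = p)
    (k : ℕ) : Finset.card {F : Set α | Stable d F k} ≤ 2 ^ k * 2 ^ 2 ^ k := by
  let window : Set α → α → Set (Fin k) := fun F p => {i | d^[i] p ∈ F}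
  have hwindow : ∀ F p q, window F p = window F q → Agree d F k p q := by
    intro F p q h i hi
    exact Set.ext_iff.1 h ⟨i, hi⟩
  let code : Set α → Set (Fin k) × Set (Set (Fin k)) := fun F =>
    (window F s, {w | ∃ p, window F p = w ∧ d^[k] p ∈ F})
  -- Stability enters only here: states with equal windows have the same value `k` steps ahead.
  have hcode : ∀ F, Stable d F k → ∀ p, (d^[k] p ∈ F ↔ window F p ∈ (code F).2) := by
    intro F hF p
    refine ⟨fun h => ⟨p, rfl, h⟩, ?_⟩
    rintro ⟨q, hq, h⟩
    exact (hF _ _ (hwindow F q p hq) k (by omega)).1 h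
  have hinj : Set.InjOn code {F : Set α | Stable d F k} := by
    intro F hF F' hF' h
    have h1 : window F s = window F' s := congrArg Prod.fst h
    have h2 : (code F).2 = (code F').2 := congrArg Prod.snd h
    have key : ∀ m, (d^[m] s ∈ F ↔ d^[m] s ∈ F') := by
      intro m
      induction m using Nat.strong_induction_on with
      | _ m ih =>
        rcases lt_or_ge m k with hm | hm
        · exact Set.ext_iff.1 h1 ⟨m, hm⟩
        · have e : d^[m] s = d^[k] (d^[m - k] s) := by
            rw [← Function.iterate_add_apply, Nat.add_sub_cancel' hm]
          have hw : window F (d^[m - k] s) = window F' (d^[m - k] s) := by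
            ext i
            simp only [window, Set.mem_ofPred_eq, ← Function.iterate_add_apply]
            exact ih _ (by omega)
          rw [e, hcode F hF, hcode F' hF', hw, h2]
    ext p
    obtain ⟨m, rfl⟩ := hs p
    exact key m
  calc Finset.card {F : Set α | Stable d F k}
      ≤ (Finset.univ : Finset (Set (Fin k) × Set (Set (Fin k)))).card :=
        Finset.card_le_card_of_injOn code (fun _ _ => Finset.mem_coe.2 (Finset.mem_univ _))
          (by simpa using hinj)
    _ = 2 ^ k * 2 ^ 2 ^ k := by simp

/-! ## Averages over systems of representatives -/

/-- The transition map of a unary automaton. -/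
def next {n : ℕ} (M : UnaryDFA n) : Fin n → Fin n := fun p => M.step p ()

theorem eval_eq_iterate {n : ℕ} (M : UnaryDFA n) (w : List Unit) :
    M.eval w = (next M)^[w.length] M.start := by
  induction w using List.reverseRecOn with
  | nil => rfl
  | append_singleton w a ih =>
    rw [DFA.eval_append_singleton, ih, List.length_append, List.length_singleton,
      Function.iterate_succ_apply']
    rfl

theorem accessible_iff {n : ℕ} (M : UnaryDFA n) :
    Accessible M ↔ ∀ p, ∃ i, (next M)^[i] M.start = p := by
  refine forall_congr' fun p => ⟨?_, ?_⟩
  · rintro ⟨w, rfl⟩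
    exact ⟨w.length, (eval_eq_iterate M w).symm⟩
  · rintro ⟨i, rfl⟩
    exact ⟨List.replicate i (), by rw [eval_eq_iterate, List.length_replicate]⟩

theorem iterate_next_reindex {n : ℕ} (M : UnaryDFA n) (e : Fin n ≃ Fin n) (i : ℕ) (p : Fin n) :
    (next (DFA.reindex e M))^[i] (e p) = e ((next M)^[i] p) := by
  have h : Function.Semiconj e (next M) (next (DFA.reindex e M)) := fun q => by
    simp [next, DFA.reindex]
  exact (h.iterate_right i p).symm

theorem accessible_reindex {n : ℕ} {M : UnaryDFA n} (h : Accessible M) (e : Fin n ≃ Fin n) :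
    Accessible (DFA.reindex e M) := by
  intro p
  obtain ⟨w, hw⟩ := h (e.symm p)
  exact ⟨w, by rw [DFA.eval_reindex, hw, e.apply_symm_apply]⟩

/-- Each state is named by a word leading to it, so the relabelled automaton reveals the
relabelling. Hence there are no nontrivial automorphisms. -/
theorem Accessible.equiv_eq {n : ℕ} {M : UnaryDFA n} (h : Accessible M) {e e' : Fin n ≃ Fin n}
    (he : DFA.reindex e M = DFA.reindex e' M) : e = e' := by
  ext p
  obtain ⟨w, rfl⟩ := h p
  rw [← DFA.eval_reindex, he, DFA.eval_reindex]

theorem agree_reindex {n : ℕ} (M : UnaryDFA n) (e : Fin n ≃ Fin n) (k : ℕ) (p q : Fin n) :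
    Agree (next (DFA.reindex e M)) (DFA.reindex e M).accept k (e p) (e q) ↔
      Agree (next M) M.accept k p q := by
  refine forall₂_congr fun i _ => ?_
  rw [iterate_next_reindex, iterate_next_reindex]
  simp [DFA.reindex]

theorem stable_reindex {n : ℕ} (M : UnaryDFA n) (e : Fin n ≃ Fin n) (k : ℕ) :
    Stable (next (DFA.reindex e M)) (DFA.reindex e M).accept k ↔ Stable (next M) M.accept k := by
  constructor
  · intro h p q
    rw [← agree_reindex M e, ← agree_reindex M e]
    exact h _ _
  · intro h p q
    obtain ⟨p, rfl⟩ := e.surjective p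
    obtain ⟨q, rfl⟩ := e.surjective q
    rw [agree_reindex, agree_reindex]
    exact h _ _

/-- The unary automaton with given transition map, initial state and final states. -/
def ofTriple {n : ℕ} (x : ((Fin n → Fin n) × Fin n) × Set (Fin n)) : UnaryDFA n :=
  ⟨fun p _ => x.1.1 p, x.1.2, x.2⟩

/-- The transition map, initial state and set of final states of a unary automaton. -/
def toTriple {n : ℕ} (M : UnaryDFA n) : ((Fin n → Fin n) × Fin n) × Set (Fin n) :=
  ((next M, M.start), M.accept)

theorem ofTriple_toTriple {n : ℕ} (M : UnaryDFA n) : ofTriple (toTriple M) = M := rfl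

theorem toTriple_ofTriple {n : ℕ} (x : ((Fin n → Fin n) × Fin n) × Set (Fin n)) :
    toTriple (ofTriple x) = x := rfl

open Classical in
/-- The pairs of a transition map and an initial state from which all states are reached. -/
noncomputable def accessiblePairs (n : ℕ) : Finset ((Fin n → Fin n) × Fin n) :=
  {x | ∀ p, ∃ i, x.1^[i] x.2 = p}

theorem isomorphic_reindex {n : ℕ} (M : UnaryDFA n) (e : Fin n ≃ Fin n) :
    Isomorphic (DFA.reindex e M) M :=
  ⟨e.symm, by rw [← DFA.symm_reindex, Equiv.symm_apply_apply]⟩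

-- Relabelling representatives by all permutations hits every labelled accessible automaton exactly
-- once. This is why the choice of labelling is irrelevant to the counts.
open Classical in
theorem card_filter_mul_factorial {n : ℕ} {S : Finset (UnaryDFA n)}
    (hS : IsSystemOfUnaryAutomata S) (P : UnaryDFA n → Prop)
    (hP : ∀ M (e : Fin n ≃ Fin n), P (DFA.reindex e M) ↔ P M) :
    (S.filter P).card * n.factorial =
      ((accessiblePairs n ×ˢ Finset.univ).filter fun x => P (ofTriple x)).card := by
  have hcard : (S.filter P).card * n.factorial =
      (S.filter P ×ˢ (Finset.univ : Finset (Fin n ≃ Fin n))).card := by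
    rw [Finset.card_product, Finset.card_univ, Fintype.card_perm, Fintype.card_fin]
  rw [hcard]
  refine Finset.card_nbij (fun x => toTriple (DFA.reindex x.2 x.1)) ?_ ?_ ?_
  · rintro ⟨M, e⟩ h
    simp only [Finset.mem_product, Finset.mem_filter, Finset.mem_univ, and_true,
      Finset.mem_coe] at h ⊢
    refine ⟨?_, by rw [ofTriple_toTriple, hP]; exact h.2⟩
    exact Finset.mem_filter.2 ⟨Finset.mem_univ _,
      (accessible_iff _).1 (accessible_reindex (hS.1 M h.1) e)⟩
  · rintro ⟨M, e⟩ h ⟨M', e'⟩ h' heq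
    simp only [Finset.coe_product, Set.mem_prod, Finset.mem_coe, Finset.mem_filter] at h h'
    have heq : DFA.reindex e M = DFA.reindex e' M' := congrArg ofTriple heq
    obtain ⟨N, -, hN⟩ := hS.2 _ (accessible_reindex (hS.1 M h.1.1) e)
    have h1 := hN M ⟨h.1.1, isomorphic_reindex M e⟩
    have h2 := hN M' ⟨h'.1.1, heq ▸ isomorphic_reindex M' e'⟩
    obtain rfl : M = M' := h1.trans h2.symm
    rw [(hS.1 M h.1.1).equiv_eq heq]
  · intro x hx
    simp only [Finset.mem_coe, Finset.mem_filter, Finset.mem_product, Finset.mem_univ,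
      and_true, accessiblePairs, true_and] at hx
    obtain ⟨N, ⟨hN, e, he⟩, -⟩ := hS.2 (ofTriple x) ((accessible_iff _).2 hx.1)
    have hx' : DFA.reindex e.symm N = ofTriple x := by
      rw [← he, ← DFA.symm_reindex, Equiv.symm_apply_apply]
    refine ⟨(N, e.symm), ?_, ?_⟩
    · simp only [Finset.coe_product, Set.mem_prod, Finset.mem_coe, Finset.mem_filter,
        Finset.mem_univ, and_true]
      exact ⟨hN, by rw [← he, hP]; exact hx.2⟩
    · change toTriple (DFA.reindex e.symm N) = x
      rw [hx', toTriple_ofTriple]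

open Classical in
/-- A bound, uniform in the accessible transition structure, on the number of sets of final states
with a given property gives a bound on the number of automata with this property. -/
theorem mul_card_filter_le {n : ℕ} {S : Finset (UnaryDFA n)} (hS : IsSystemOfUnaryAutomata S)
    (P : UnaryDFA n → Prop) (hP : ∀ M (e : Fin n ≃ Fin n), P (DFA.reindex e M) ↔ P M) (b c : ℕ)
    (h : ∀ x ∈ accessiblePairs n,
      c * Finset.card {F : Set (Fin n) | P (ofTriple (x, F))} ≤ b * 2 ^ n) :
    c * (S.filter P).card ≤ b * S.card := by
  have h1 := card_filter_mul_factorial hS P hP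
  -- The trivial property expresses the size of `S` as the number of accessible pairs times `2 ^ n`,
  -- up to the same factor `n!`.
  have h2 := card_filter_mul_factorial hS (fun _ => True) (fun _ _ => Iff.rfl)
  simp only [Finset.filter_true, Finset.card_product, Finset.card_univ, Fintype.card_set,
    Fintype.card_fin] at h2
  have h3 : ((accessiblePairs n ×ˢ Finset.univ).filter fun x => P (ofTriple x)).card =
      ∑ x ∈ accessiblePairs n, Finset.card {F : Set (Fin n) | P (ofTriple (x, F))} := by
    rw [Finset.card_filter, Finset.sum_product]
    simp only [Finset.card_filter]
  have h4 : c * (S.filter P).card * n.factorial ≤ b * S.card * n.factorial := by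
    rw [mul_assoc, h1, h3, mul_assoc, h2, Finset.mul_sum, mul_left_comm, ← smul_eq_mul
      (accessiblePairs n).card]
    exact Finset.sum_le_card_nsmul _ _ _ h
  exact Nat.le_of_mul_le_mul_right h4 n.factorial_pos

/-- A cycle will do; this guarantees that averages do not divide by zero. -/
theorem exists_accessible (n : ℕ) (hn : 1 ≤ n) : ∃ M : UnaryDFA n, Accessible M := by
  obtain ⟨m, rfl⟩ : ∃ m, n = m + 1 := ⟨n - 1, by omega⟩
  refine ⟨ofTriple ((fun p => p + 1, 0), ∅), (accessible_iff _).2 fun p => ⟨p, ?_⟩⟩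
  have h : ∀ i ≤ m, (((fun p : Fin (m + 1) => p + 1)^[i] 0 : Fin (m + 1)) : ℕ) = i := by
    intro i
    induction i with
    | zero => simp
    | succ i ih =>
      intro hi
      have hi' := ih (by omega)
      rw [Function.iterate_succ_apply', Fin.val_add_one_of_lt, hi']
      rw [Fin.lt_def, hi']
      simpa using hi
  exact Fin.ext (h p (Nat.lt_succ_iff.1 p.2))

theorem card_pos_of_isSystem {n : ℕ} (hn : 1 ≤ n) {S : Finset (UnaryDFA n)}
    (hS : IsSystemOfUnaryAutomata S) : 0 < S.card := by
  obtain ⟨M, hM⟩ := exists_accessible n hn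
  obtain ⟨N, ⟨hN, -⟩, -⟩ := hS.2 M hM
  exact Finset.card_pos.2 ⟨N, hN⟩

/-- The least `k` such that words of length `k` do not distinguish more states than shorter ones. -/
noncomputable def depth {n : ℕ} (M : UnaryDFA n) : ℕ :=
  sInf {k | Stable (next M) M.accept k}

theorem stable_depth {n : ℕ} (M : UnaryDFA n) : Stable (next M) M.accept (depth M) :=
  Nat.sInf_mem (s := {k | Stable (next M) M.accept k}) ⟨_, stable_card_succ _ _⟩

theorem depth_le {n : ℕ} {M : UnaryDFA n} {k : ℕ} (h : Stable (next M) M.accept k) :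
    depth M ≤ k :=
  Nat.sInf_le h

theorem depth_le_succ {n : ℕ} (M : UnaryDFA n) : depth M ≤ n + 1 := by
  simpa using depth_le (stable_card_succ (next M) M.accept)

theorem HaltsIn.unique {n : ℕ} {M : UnaryDFA n} {t t' : ℕ} (h : HaltsIn M t)
    (h' : HaltsIn M t') : t = t' := by
  obtain ⟨s, e⟩ := h
  obtain ⟨s', e'⟩ := h'
  exact (e.deterministic e').1

theorem existsUnique_haltsIn {n : ℕ} (M : UnaryDFA n) : ∃! t : ℕ, HaltsIn M t := by
  obtain ⟨t, h, -⟩ := exists_haltsIn M (stable_depth M)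
    (fun k hk h => absurd (depth_le h) (by omega))
  exact ⟨t, h, fun t' h' => h'.unique h⟩

theorem time_bounds {n : ℕ} (M : UnaryDFA n) :
    n * depth M ≤ time M ∧ time M ≤ 2000 * (n + 1) * (depth M + 1) := by
  obtain ⟨t, h, h1, h2⟩ := exists_haltsIn M (stable_depth M)
    (fun k hk h => absurd (depth_le h) (by omega))
  have : time M = t := (Nat.sInf_mem (s := {t | HaltsIn M t}) ⟨t, h⟩ : HaltsIn M _).unique h
  rw [this]
  exact ⟨h1, h2⟩

/-! ### Upper and lower bounds on the total running time -/

theorem sum_time_le {n : ℕ} (hn : 1 ≤ n) {S : Finset (UnaryDFA n)}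
    (hS : IsSystemOfUnaryAutomata S) :
    ∑ M ∈ S, time M ≤ 2000 * (n + 1) * (3 * Nat.log 2 n + 6) * S.card := by
  classical
  -- Chosen so that `2 ^ L ≥ n ^ 3`: the union bound then leaves a proportion of at most `1 / n`,
  -- which offsets the worst-case depth `n + 1`.
  set L := 3 * (Nat.log 2 n + 1) with hL
  obtain ⟨P, hP⟩ : ∃ P : UnaryDFA n → Prop, ∀ M, P M ↔ ¬ Stable (next M) M.accept L :=
    ⟨_, fun _ => Iff.rfl⟩
  have hbad : 2 ^ L * (S.filter P).card ≤ n ^ 2 * S.card := by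
    refine mul_card_filter_le hS P
      (fun M e => by rw [hP, hP, stable_reindex]) _ _ fun x _ => ?_
    have hx : ∀ F, P (ofTriple (x, F)) ↔ ¬ Stable x.1 F L := fun F => hP _
    simp only [hx]
    simpa using card_not_stable_mul_two_pow_le x.1 L
  have hpow : n ^ 3 ≤ 2 ^ L := by
    rw [hL, mul_comm, pow_mul]
    exact Nat.pow_le_pow_left (Nat.lt_pow_succ_log_self (by omega) n).le 3
  have hbad' : n * (S.filter P).card ≤ S.card := by
    have h1 := (Nat.mul_le_mul_right (S.filter P).card hpow).trans hbad
    have h2 : n ^ 2 * (n * (S.filter P).card) ≤ n ^ 2 * S.card := by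
      rw [← mul_assoc, ← pow_succ]; exact h1
    exact Nat.le_of_mul_le_mul_left h2 (by positivity)
  have hdepth : ∀ M ∈ S, depth M + 1 ≤ (L + 1) + if P M then n + 1 else 0 := by
    intro M _
    split_ifs with h
    · have := depth_le_succ M
      omega
    · have := depth_le (not_not.1 (mt (hP M).2 h))
      omega
  have hsum : ∑ M ∈ S, (depth M + 1) ≤ (3 * Nat.log 2 n + 6) * S.card := by
    refine (Finset.sum_le_sum hdepth).trans ?_
    rw [Finset.sum_add_distrib, Finset.sum_const, ← Finset.sum_filter, Finset.sum_const,
      smul_eq_mul, smul_eq_mul]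
    have h1 : (S.filter P).card * (n + 1) ≤ 2 * S.card := by nlinarith
    have h2 : (3 * Nat.log 2 n + 6) * S.card = S.card * (L + 1) + 2 * S.card := by
      rw [hL]; ring
    exact (Nat.add_le_add_left h1 _).trans h2.ge
  calc ∑ M ∈ S, time M ≤ ∑ M ∈ S, 2000 * (n + 1) * (depth M + 1) :=
        Finset.sum_le_sum fun M _ => (time_bounds M).2
    _ = 2000 * (n + 1) * ∑ M ∈ S, (depth M + 1) := (Finset.mul_sum _ _ _).symm
    _ ≤ _ := by
        rw [mul_assoc _ (3 * Nat.log 2 n + 6)]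
        exact Nat.mul_le_mul_left _ hsum

theorem le_two_mul_sum_time {n : ℕ} (hn : 2 ≤ n) {S : Finset (UnaryDFA n)}
    (hS : IsSystemOfUnaryAutomata S) :
    n * Nat.log 2 n * S.card ≤ 2 * ∑ M ∈ S, time M := by
  classical
  obtain ⟨k, hk⟩ : ∃ k, Nat.log 2 n = k + 1 :=
    ⟨Nat.log 2 n - 1, by have := Nat.log_pos one_lt_two hn; omega⟩
  let P : UnaryDFA n → Prop := fun M => Stable (next M) M.accept k
  -- Since `k < 2 ^ k`, the exponent `1 + k + 2 ^ k` is at most `2 ^ (k + 1) ≤ n`. At least half of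
  -- the automata therefore have depth at least `k + 1`.
  have hpow : 2 * (2 ^ k * 2 ^ 2 ^ k) ≤ 2 ^ n := by
    have h1 : 2 ^ (k + 1) ≤ n := hk ▸ Nat.pow_log_le_self 2 (by omega)
    have h2 : k < 2 ^ k := Nat.lt_two_pow_self
    rw [pow_succ] at h1
    rw [← pow_add, ← pow_succ']
    exact Nat.pow_le_pow_right (by omega) (by omega)
  have hbad : 2 * (S.filter P).card ≤ 1 * S.card := by
    refine mul_card_filter_le hS P (fun M e => stable_reindex M e k) _ _ fun x hx => ?_
    rw [one_mul]
    refine le_trans (Nat.mul_le_mul_left 2 ?_) hpow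
    exact card_stable_le x.1 x.2 (Finset.mem_filter.1 hx).2 k
  have hgood : S.card ≤ 2 * (S.filter fun M => ¬ P M).card := by
    have := Finset.card_filter_add_card_filter_not (s := S) P
    omega
  have hsum : (S.filter fun M => ¬ P M).card * (n * (k + 1)) ≤ ∑ M ∈ S, time M := by
    refine le_trans ?_ (Finset.sum_le_sum_of_subset (Finset.filter_subset (fun M => ¬ P M) S))
    rw [← smul_eq_mul]
    refine Finset.card_nsmul_le_sum _ _ _ fun M hM => ?_
    refine le_trans (Nat.mul_le_mul_left n ?_) (time_bounds M).1
    by_contra hlt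
    exact (Finset.mem_filter.1 hM).2 ((stable_depth M).mono (by omega))
  rw [hk]
  have := Nat.mul_le_mul_right (n * (k + 1)) hgood
  nlinarith

/-! ### Comparison of the binary and natural logarithms -/

theorem log_le_two_mul_natLog {n : ℕ} (hn : 2 ≤ n) : Real.log n ≤ 2 * (Nat.log 2 n : ℝ) := by
  have h1 : (n : ℝ) ≤ 2 ^ (Nat.log 2 n + 1) := by
    exact_mod_cast (Nat.lt_pow_succ_log_self (by omega) n).le
  have h2 := Real.log_le_log (by positivity) h1
  rw [Real.log_pow] at h2
  have h3 : (1 : ℝ) ≤ Nat.log 2 n := by exact_mod_cast Nat.log_pos one_lt_two hn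
  have h4 := Real.log_two_lt_d9
  push_cast at h2
  nlinarith

theorem natLog_le_two_mul_log {n : ℕ} (hn : 2 ≤ n) : (Nat.log 2 n : ℝ) ≤ 2 * Real.log n := by
  have h1 : (2 : ℝ) ^ Nat.log 2 n ≤ n := by exact_mod_cast Nat.pow_log_le_self 2 (by omega)
  have h2 := Real.log_le_log (by positivity) h1
  rw [Real.log_pow] at h2
  have h3 : (0 : ℝ) ≤ Nat.log 2 n := Nat.cast_nonneg _
  have h4 := Real.log_two_gt_d9
  nlinarith

end Moore

theorem mainTheorem3 :
    (∀ (n : ℕ) (M : Moore.UnaryDFA n), Moore.Accessible M → ∃! t : ℕ, Moore.HaltsIn M t) ∧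
    ∀ S : (n : ℕ) → Finset (Moore.UnaryDFA n),
      (∀ n : ℕ, Moore.IsSystemOfUnaryAutomata (S n)) →
      Asymptotics.IsTheta Filter.atTop
        (fun n : ℕ => Moore.averageTime (S n))
        (fun n : ℕ => (n : ℝ) * Real.log (n : ℝ)) := by
  refine ⟨fun n M _ => Moore.existsUnique_haltsIn M, fun S hS => ⟨?_, ?_⟩⟩
  · refine Asymptotics.IsBigO.of_bound 100000 ?_
    filter_upwards [Filter.eventually_ge_atTop 2] with n hn
    have hcard : (0 : ℝ) < (S n).card := by
      exact_mod_cast Moore.card_pos_of_isSystem (by omega) (hS n)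
    have hsum : (∑ M ∈ S n, (Moore.time M : ℝ)) ≤
        2000 * (n + 1) * (3 * Nat.log 2 n + 6) * (S n).card := by
      exact_mod_cast Moore.sum_time_le (by omega) (hS n)
    have havg : Moore.averageTime (S n) ≤ 2000 * (n + 1) * (3 * Nat.log 2 n + 6) := by
      rw [Moore.averageTime, div_le_iff₀ hcard]
      exact hsum
    have hn' : (2 : ℝ) ≤ n := by exact_mod_cast hn
    have hlog : (1 : ℝ) ≤ 2 * Real.log n := by
      have := Real.log_le_log (by norm_num) hn'
      have := Real.log_two_gt_d9
      linarith
    have hlog' := Moore.natLog_le_two_mul_log hn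
    rw [Real.norm_of_nonneg (by unfold Moore.averageTime; positivity),
      Real.norm_of_nonneg (by nlinarith)]
    calc Moore.averageTime (S n) ≤ 2000 * (n + 1) * (3 * Nat.log 2 n + 6) := havg
      -- The 18 is 6 from `3 * Nat.log 2 n ≤ 6 * Real.log n` plus 12 from `6 ≤ 12 * Real.log n`.
      _ ≤ 2000 * (2 * n) * (18 * Real.log n) := by
          gcongr
          · linarith
          · linarith
      _ ≤ 100000 * (n * Real.log n) := by nlinarith
  -- One factor 2 comes from the logarithms, the other from using only half of the automata.
  · refine Asymptotics.IsBigO.of_bound 4 ?_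
    filter_upwards [Filter.eventually_ge_atTop 2] with n hn
    have hcard : (0 : ℝ) < (S n).card := by
      exact_mod_cast Moore.card_pos_of_isSystem (by omega) (hS n)
    have hsum : (n * Nat.log 2 n * (S n).card : ℝ) ≤ 2 * ∑ M ∈ S n, (Moore.time M : ℝ) := by
      exact_mod_cast Moore.le_two_mul_sum_time hn (hS n)
    have havg : (n * Nat.log 2 n : ℝ) ≤ 2 * Moore.averageTime (S n) := by
      rw [Moore.averageTime, ← mul_div_assoc, le_div_iff₀ hcard]
      exact hsum
    have hn' : (2 : ℝ) ≤ n := by exact_mod_cast hn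
    have hlog := Moore.log_le_two_mul_natLog hn
    rw [Real.norm_of_nonneg (mul_nonneg (by linarith) (Real.log_nonneg (by linarith))),
      Real.norm_of_nonneg (by unfold Moore.averageTime; positivity)]
    nlinarith
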